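/- **Conventions.** Let $\mathcal X$ be any set with a distinguished null element $\bot\in\mathcal X$, and let $\mathcal X^*=\bigcup_{n\in\mathbb N}\mathcal X^n$. For $x,x'\in\mathcal X^n$ write $|x|=|\{i:x_i\neq\bot\}|$; $x'\subseteq x$ if for every $i$ either $x'_i=x_i$ or $x'_i=\bot$; and let $x\setminus x'$ be the tuple with $i$-th entry $\bot$ if $x_i=x'_i$ and $x_i$ otherwise. For $S\subseteq[n]$ let $x_S$ agree with $x$ on $S$ and be $\bot$ elsewhere. Tuples $x,x'\in\mathcal X^n$ are neighbouring if $|x\setminus x'|+|x'\setminus x|=1$. A function on $\mathcal X^*$ is *null-invariant* if inserting a $\bot$ at any position of its argument does not change its value. A function $g$ on $\mathcal X^*$ is *monotone* if $x'\subseteq x$ implies $g(x')\le g(x)$. A randomised algorithm $M$ on $\mathcal X^*$ assigns to each input the probability law of its output. It is $\rho$-zCDP if $D_\alpha(M(x)\,\|\,M(x'))\le\rho\alpha$ for all neighbouring $x,x'$ and all $\alpha\in(1,\infty)$, where $D_\alpha$ is the Rényi divergence. It is $\mu$-GDP if $T(M(x),M(x'))\ge T(\mathcal N(0,1),\mathcal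 N(\mu,1))$ pointwise on $[0,1]$ for all neighbouring $x,x'$, where $T(P,Q)(a)$ is the smallest type II error of a (randomised) test of $P$ against $Q$ with type I error at most $a$. A square root of a negative number, and $\log 0$, are read as $0$. **Theorem.** 1. *(Shifted inverse mechanism.)* There is an absolute constant $C>0$ such that the following holds for every $\mathcal X$, every finite $\mathcal Y\subseteq\mathbb R$ and all $\rho,\beta>0$. For every monotone $g:\mathcal X^*\to\mathcal Y$ there is a randomised algorithm $M:\mathcal X^*\to\mathcal Y$ that is $\rho$-zCDP and $\sqrt{2\rho}$-GDP and satisfies, for all $x\in\mathcal X^*$, $$\Pr\bigl[g(x)\ge M(x)\ge\min\{g(x'):x'\subseteq x,\ |x'|\ge|x|-t\}\bigr]\ge 1-\beta,\qquad t=C\sqrt{\log(|\mathcal Y|/\beta)/\rho}.$$ Furthermore, $M(x)$ depends only on the values $g(x')$ for $x'\subseteq x$: there are maps $\Phi_n$ ($n\in\mathbb N$), not depending on $g$, such that for every $n$ and every $x\in\mathcal X^n$ the law of $M(x)$ is $\Phi_n\bigl((g(x_S))_{S\subseteq[n]}\bigr)$. If $g$ is null-invariant, then so is $M$. 2. *(Differentially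 private binary search.)* There is an absolute constant $C>0$ such that the following holds for every $\mathcal X$ and $m\in\mathbb N$, all $\rho,\beta>0$ and $\tau\in\mathbb R$, and every $\ell:\mathcal X^*\times[m]\to\mathbb R$ that has sensitivity $1$ in its first argument ($|\ell(x,y)-\ell(x',y)|\le|x\setminus x'|+|x'\setminus x|$ for all $n$ and $x,x'\in\mathcal X^n$) and is decreasing (non-increasing) in its second. There are $0\le\eta\le C\sqrt{\log(m/\beta)/\rho}$ and a $\rho$-zCDP and $\sqrt{2\rho}$-GDP algorithm $M:\mathcal X^*\to[m+1]$ such that, for all $x\in\mathcal X^*$, with probability at least $1-\beta$ both $\ell(x,M(x))<\tau+\eta$ and $\ell(x,M(x)-1)>\tau-\eta$, where $\ell(x,0)=\infty$ and $\ell(x,m+1)=-\infty$. If $\ell$ is null-invariant in its first argument, then so is $M$. 3. *(Shifted inverse loss.)* For every monotone $g:\mathcal X^*\to\mathbb R$, the loss $\ell(x,y)=\min\{|x\setminus\tilde x|:\tilde x\subseteq x,\ g(\tilde x)\le y\}\in\mathbb N\cup\{\infty\}$ is decreasing (non-increasing) in $y\in\mathbb R$; and for all $n$, all $x,x'\in\mathcal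 X^n$ and all $y\ge g(\bot,\dots,\bot)$ (the all-null tuple of length $n$), $\ell(x,y)$ and $\ell(x',y)$ are finite and $|\ell(x,y)-\ell(x',y)|\le|x\setminus x'|+|x'\setminus x|$. -/

import Mathlib

open MeasureTheory ProbabilityTheory
open scoped ENNReal NNReal

universe u

namespace ShiftedInverse

/-! ### Datasets: tuples with a null element `⊥`, treated as sets -/

section Datasets

variable {𝒳 : Type u} [Bot 𝒳] {n : ℕ}

/-- `𝒳* = ⋃ₙ 𝒳ⁿ`, the tuples of arbitrary length. -/
abbrev Dataset (𝒳 : Type u) : Type u := Σ n : ℕ, Fin n → 𝒳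

/-- `|x|`, the number of non-null entries of the tuple `x`. -/
noncomputable def size (x : Fin n → 𝒳) : ℕ := {i : Fin n | x i ≠ ⊥}.ncard

/-- `x' ⊆ x`: the tuple `x'` arises from `x` by replacing some entries with nulls. -/
def IsSub (x' x : Fin n → 𝒳) : Prop := ∀ i, x' i = x i ∨ x' i = ⊥

open Classical in
/-- `x \ x'`: the entries of `x` at the positions where `x` and `x'` differ, nulls elsewhere. -/
noncomputable def diff (x x' : Fin n → 𝒳) : Fin n → 𝒳 :=
  fun i => if x i = x' i then ⊥ else x i

/-- `x_S`: the entries of `x` with index in `S`, nulls elsewhere. -/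
def restrict (x : Fin n → 𝒳) (S : Finset (Fin n)) : Fin n → 𝒳 :=
  fun i => if i ∈ S then x i else ⊥

/-- The distance `|x \ x'| + |x' \ x|` between two tuples of the same length. -/
noncomputable def tupleDist (x x' : Fin n → 𝒳) : ℕ := size (diff x x') + size (diff x' x)

/-- Neighbouring tuples: one differs from the other by the addition or removal of one element. -/
def Neighbouring (x x' : Fin n → 𝒳) : Prop := tupleDist x x' = 1

/-- Nulls are equivalent to missing entries: inserting a null at any position of a tuple does not
change the value of `f`. -/
def NullInvariant {Z : Type*} (f : Dataset 𝒳 → Z) : Prop :=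
  ∀ (n : ℕ) (x : Fin n → 𝒳) (i : Fin (n + 1)),
    f ⟨n + 1, Fin.insertNth (α := fun _ => 𝒳) i ⊥ x⟩ = f ⟨n, x⟩

/-- `x' ⊆ x` implies `g(x') ≤ g(x)`. -/
def SubsetMonotone {Z : Type*} [LE Z] (g : Dataset 𝒳 → Z) : Prop :=
  ∀ (n : ℕ) (x' x : Fin n → 𝒳), IsSub x' x → g ⟨n, x'⟩ ≤ g ⟨n, x⟩

/-- The table of all the values `g(x')` with `x' ⊆ x`, indexed by the sets `S ⊆ [n]`; the subsets
of `x` are exactly the tuples `x_S`. -/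
def subsetValues {Z : Type*} (g : Dataset 𝒳 → Z) (x : Fin n → 𝒳) : Finset (Fin n) → Z :=
  fun S => g ⟨n, restrict x S⟩

/-- `min {g(x') : x' ⊆ x, |x'| ≥ |x| - t}`. The set is finite, and for `t ≥ 0` it contains `g(x)`,
so the infimum is a minimum. -/
noncomputable def minAfterRemoval (g : Dataset 𝒳 → ℝ) (x : Fin n → 𝒳) (t : ℝ) : ℝ :=
  sInf {v : ℝ | ∃ x' : Fin n → 𝒳, IsSub x' x ∧ (size x : ℝ) - t ≤ size x' ∧ g ⟨n, x'⟩ = v}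

/-- The shifted inverse loss `ℓ(x, y) = min {|x \ x'| : x' ⊆ x, g(x') ≤ y}`, which is `∞` if there
is no such `x'`. -/
noncomputable def shiftedInverseLoss (g : Dataset 𝒳 → ℝ) (x : Fin n → 𝒳) (y : ℝ) : ℕ∞ :=
  sInf {v : ℕ∞ | ∃ x' : Fin n → 𝒳, IsSub x' x ∧ g ⟨n, x'⟩ ≤ y ∧ v = (size (diff x x') : ℕ∞)}

end Datasets

/-! ### Concentrated and Gaussian differential privacy -/

section Privacy

variable {Ω : Type*} [MeasurableSpace Ω]

/-- The Rényi divergence `D_α(P ‖ Q) = (α - 1)⁻¹ log ∫ (dP/dQ)^α dQ` of order `α > 1` of two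
probability measures, `∞` unless `P` is absolutely continuous with respect to `Q`. -/
noncomputable def renyiDiv (α : ℝ) (P Q : Measure Ω) : EReal :=
  open Classical in
  if P ≪ Q then (((α - 1)⁻¹ : ℝ) : EReal) * ENNReal.log (∫⁻ ω, P.rnDeriv Q ω ^ α ∂Q) else ⊤

/-- The trade-off function `T(P, Q)(a)`: the smallest type II error of a (randomised) test of `P`
against `Q` with type I error at most `a`. -/
noncomputable def tradeoff (P Q : Measure Ω) (a : ℝ) : ℝ :=
  sInf {b : ℝ | ∃ φ : Ω → ℝ, Measurable φ ∧ (∀ ω, 0 ≤ φ ω ∧ φ ω ≤ 1) ∧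
    ∫ ω, φ ω ∂P ≤ a ∧ b = 1 - ∫ ω, φ ω ∂Q}

variable {𝒳 : Type u} [Bot 𝒳]

/-- `ρ`-zCDP (zero-concentrated differential privacy) of a randomised algorithm, given as the map
from the input to the law of the output. -/
def IsZCDP (ρ : ℝ) (M : Dataset 𝒳 → ProbabilityMeasure Ω) : Prop :=
  ∀ (n : ℕ) (x x' : Fin n → 𝒳), Neighbouring x x' → ∀ α : ℝ, 1 < α →
    renyiDiv α (M ⟨n, x⟩ : Measure Ω) (M ⟨n, x'⟩ : Measure Ω) ≤ ((ρ * α : ℝ) : EReal)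

/-- `μ`-GDP (Gaussian differential privacy): distinguishing the outputs on two neighbouring inputs
is at least as hard as distinguishing `N(0, 1)` from `N(μ, 1)`. -/
def IsGDP (μ : ℝ) (M : Dataset 𝒳 → ProbabilityMeasure Ω) : Prop :=
  ∀ (n : ℕ) (x x' : Fin n → 𝒳), Neighbouring x x' → ∀ a : ℝ, 0 ≤ a → a ≤ 1 →
    tradeoff (gaussianReal 0 1) (gaussianReal μ 1) a ≤
      tradeoff (M ⟨n, x⟩ : Measure Ω) (M ⟨n, x'⟩ : Measure Ω) a

end Privacy

/-- A function `f` on `[m]`, extended to all indices `k ∈ ℕ` by `f(0) = ∞` and `f(k) = -∞` for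
`k > m`. The element `k ∈ [m] = {1, …, m}` is represented by `k - 1 : Fin m`. -/
noncomputable def extended {m : ℕ} (f : Fin m → ℝ) (k : ℕ) : EReal :=
  if k = 0 then ⊤ else if h : k - 1 < m then ((f ⟨k - 1, h⟩ : ℝ) : EReal) else ⊥

end ShiftedInverse

open ShiftedInverse

/-!
All the privacy guarantees come from one fact: on neighbouring inputs the pair of output laws is the
image of the pair `(N(0, 2ρ), N(2ρ, 2ρ))`, equivalently of `(N(0, 1), N(√(2ρ), 1))`, under a single
randomised map (`GaussianSimulable`). Data processing then gives `√(2ρ)`-GDP at once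
(`tradeoff_le_of_kernel`) and `ρ`-zCDP by Hölder's inequality (`renyiDiv_le_of_kernel`). A noisy
threshold query of sensitivity one is simulable from a Gaussian pair (`GaussianSimulable.noisyBit`),
and simulability composes adaptively with addition of the variances (`GaussianSimulable.bind`),
because a Gaussian can be split into two independent ones without knowledge of the common drift
(`exists_gaussian_split`). Hence every decision tree of noisy threshold queries of depth `D`, with
noise of variance `D / (2ρ)`, meets the privacy requirement.

The error bound without an additional `log log` factor needs a noisy binary search with
`O(log (m / β))` queries, each of which is correct only with constant probability. The search keeps
multiplicative weights on the `m + 1` positions, asks in each round for both sides of the weighted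
median, and outputs the median of all these medians. Queries at levels close to the threshold have
unreliable answers; they are handled by comparison with the position `i` at which the loss crosses
the threshold exactly, about which no answer errs with probability more than `1/2`. The total weight
relative to the weight of `i` contracts in expectation in rounds with an unacceptable median and
increases only slightly in the others, so that a majority of unacceptable medians is exponentially
unlikely (`AnswerModel.failProb_search_le`). If `m = 1` a single query is used, because the allowed
error then tends to zero as `β` tends to one.

The shifted inverse mechanism is this search for the level `η` of the shifted inverse loss, evaluated
at all but the largest element of `Y` and truncated at `2η`. The truncation makes the loss finite; it
keeps the sensitivity, since at a given level the losses of two tuples of the same length are both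
finite or both infinite. The loss is a function of the table of values `g(x_S)`
(`shiftedInverseLoss_eq_tableLoss`), and the search is a fixed function of the loss.
-/

open ShiftedInverse

namespace ShiftedInverse

/-! ### Post-processing of a pair of Gaussians -/

/-- The pair `(P, Q)` of laws on a finite set is obtained from the pair `(N(0, s), N(s, s))` by one
randomised map, given as a kernel `k` with finitely many outcomes. After rescaling, the pair
`(N(0, s), N(s, s))` is `(N(0, 1), N(√s, 1))`; in the present normalisation the variances of
independent pairs add up, which is what adaptive composition needs. -/
def GaussianSimulable {Ω : Type*} [Fintype Ω] (s : ℝ≥0) (P Q : PMF Ω) : Prop :=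
  ∃ k : ℝ → Ω → ℝ≥0∞, (∀ ω, Measurable fun w => k w ω) ∧ (∀ w, ∑ ω, k w ω = 1) ∧
    (∀ ω, P ω = ∫⁻ w, k w ω ∂gaussianReal 0 s) ∧
    (∀ ω, Q ω = ∫⁻ w, k w ω ∂gaussianReal s s)

lemma GaussianSimulable.map {Ω Ω' : Type*} [Fintype Ω] [Fintype Ω'] {s : ℝ≥0} {P Q : PMF Ω}
    (h : GaussianSimulable s P Q) (f : Ω → Ω') :
    GaussianSimulable s (P.map f) (Q.map f) := by
  classical
  obtain ⟨k, hk, hk1, hP, hQ⟩ := h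
  have hm : ∀ (ω' : Ω') (ω : Ω), Measurable fun w => if ω' = f ω then k w ω else 0 := by
    intro ω' ω
    split_ifs
    · exact hk ω
    · exact measurable_const
  refine ⟨fun w ω' => ∑ ω, if ω' = f ω then k w ω else 0, fun ω' => ?_, fun w => ?_,
    fun ω' => ?_, fun ω' => ?_⟩
  · exact Finset.measurable_sum _ fun ω _ => hm ω' ω
  · rw [Finset.sum_comm]
    simpa using hk1 w
  · rw [PMF.map_apply, tsum_fintype, lintegral_finsetSum _ fun ω _ => hm ω' ω]
    refine Finset.sum_congr rfl fun ω _ => ?_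
    split_ifs <;> simp [hP]
  · rw [PMF.map_apply, tsum_fintype, lintegral_finsetSum _ fun ω _ => hm ω' ω]
    refine Finset.sum_congr rfl fun ω _ => ?_
    split_ifs <;> simp [hQ]

/-- The normalisation by which the pair `(N(0, 1), N(μ, 1))` is used for privacy accounting. -/
lemma GaussianSimulable.exists_kernel {Ω : Type*} [Fintype Ω] {s : ℝ≥0} {P Q : PMF Ω}
    (h : GaussianSimulable s P Q) :
    ∃ k : ℝ → Ω → ℝ≥0∞, (∀ ω, Measurable fun w => k w ω) ∧ (∀ w, ∑ ω, k w ω = 1) ∧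
      (∀ ω, P ω = ∫⁻ w, k w ω ∂gaussianReal 0 1) ∧
      (∀ ω, Q ω = ∫⁻ w, k w ω ∂gaussianReal (√s) 1) := by
  obtain ⟨k, hk, hk1, hP, hQ⟩ := h
  have hsq : √(s : ℝ) * √(s : ℝ) = s := Real.mul_self_sqrt s.2
  have h0 : (gaussianReal 0 1).map (√(s : ℝ) * ·) = gaussianReal 0 s := by
    rw [gaussianReal_map_const_mul]
    congr 1
    · simp
    · ext; simp [pow_two, hsq]
  have h1 : (gaussianReal (√s) 1).map (√(s : ℝ) * ·) = gaussianReal s s := by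
    rw [gaussianReal_map_const_mul]
    congr 1
    ext; simp [pow_two, hsq]
  refine ⟨fun w => k (√s * w), fun ω => (hk ω).comp (by fun_prop), fun w => hk1 _,
    fun ω => ?_, fun ω => ?_⟩
  · rw [hP, ← h0, lintegral_map (hk ω) (by fun_prop)]
  · rw [hQ, ← h1, lintegral_map (hk ω) (by fun_prop)]

/-- Data processing for trade-off functions: a test for the outcomes of `k` is a test for the
Gaussians. -/
lemma tradeoff_le_of_kernel {Ω : Type*} [Fintype Ω] [MeasurableSpace Ω]
    [MeasurableSingletonClass Ω] {μ : ℝ} {P Q : PMF Ω} {k : ℝ → Ω → ℝ≥0∞}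
    (hk : ∀ ω, Measurable fun w => k w ω) (hk1 : ∀ w, ∑ ω, k w ω = 1)
    (hP : ∀ ω, P ω = ∫⁻ w, k w ω ∂gaussianReal 0 1)
    (hQ : ∀ ω, Q ω = ∫⁻ w, k w ω ∂gaussianReal μ 1) {a : ℝ} (ha : 0 ≤ a) :
    tradeoff (gaussianReal 0 1) (gaussianReal μ 1) a ≤ tradeoff P.toMeasure Q.toMeasure a := by
  have hle : ∀ w ω, k w ω ≤ 1 := fun w ω => by
    rw [← hk1 w]
    exact Finset.single_le_sum (f := fun ω => k w ω) (fun _ _ => zero_le) (Finset.mem_univ ω)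
  have hint : ∀ m ω, Integrable (fun w => (k w ω).toReal) (gaussianReal m 1) := by
    intro m ω
    refine Integrable.of_bound (hk ω).ennreal_toReal.aestronglyMeasurable 1 (ae_of_all _ fun w => ?_)
    rw [Real.norm_of_nonneg ENNReal.toReal_nonneg]
    simpa using ENNReal.toReal_mono ENNReal.one_ne_top (hle w ω)
  have key : ∀ (m : ℝ) (N : PMF Ω), (∀ ω, N ω = ∫⁻ w, k w ω ∂gaussianReal m 1) → ∀ φ : Ω → ℝ,
      ∫ ω, φ ω ∂N.toMeasure = ∫ w, ∑ ω, φ ω * (k w ω).toReal ∂gaussianReal m 1 := by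
    intro m N hN φ
    rw [PMF.integral_eq_sum, integral_finsetSum _ fun ω _ => (hint m ω).const_mul _]
    refine Finset.sum_congr rfl fun ω _ => ?_
    rw [integral_const_mul, integral_toReal (hk ω).aemeasurable
      (ae_of_all _ fun w => (hle w ω).trans_lt ENNReal.one_lt_top), hN, smul_eq_mul, mul_comm]
  have hbdd : BddBelow {b : ℝ | ∃ φ : ℝ → ℝ, Measurable φ ∧ (∀ ω, 0 ≤ φ ω ∧ φ ω ≤ 1) ∧
      ∫ ω, φ ω ∂gaussianReal 0 1 ≤ a ∧ b = 1 - ∫ ω, φ ω ∂gaussianReal μ 1} := by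
    refine ⟨0, ?_⟩
    rintro b ⟨φ, hφ, hφ1, -, rfl⟩
    have : ∫ ω, φ ω ∂gaussianReal μ 1 ≤ ∫ _, (1 : ℝ) ∂gaussianReal μ 1 := by
      refine integral_mono_of_nonneg (ae_of_all _ fun w => (hφ1 w).1) (integrable_const _)
        (ae_of_all _ fun w => (hφ1 w).2)
    simp at this
    linarith
  refine csInf_le_csInf hbdd ⟨_, fun _ => 0, measurable_const, by simp, by simpa using ha, rfl⟩ ?_
  rintro b ⟨φ, -, hφ1, hφa, rfl⟩
  refine ⟨fun w => ∑ ω, φ ω * (k w ω).toReal,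
    Finset.measurable_sum _ fun ω _ => (hk ω).ennreal_toReal.const_mul _, fun w => ⟨?_, ?_⟩, ?_, ?_⟩
  · exact Finset.sum_nonneg fun ω _ => mul_nonneg (hφ1 ω).1 ENNReal.toReal_nonneg
  · calc ∑ ω, φ ω * (k w ω).toReal ≤ ∑ ω, (k w ω).toReal :=
          Finset.sum_le_sum fun ω _ => mul_le_of_le_one_left ENNReal.toReal_nonneg (hφ1 ω).2
      _ = 1 := by
          rw [← ENNReal.toReal_sum fun ω _ => ((hle w ω).trans_lt ENNReal.one_lt_top).ne, hk1]
          simp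
  · rwa [← key 0 P hP]
  · rw [key μ Q hQ]

/-- The likelihood ratio `dN(0, 1)/dN(μ, 1)`. -/
lemma gaussianReal_zero_eq_withDensity (μ : ℝ) :
    gaussianReal 0 1 = (gaussianReal μ 1).withDensity
      fun w => ENNReal.ofReal (Real.exp (μ ^ 2 / 2 - μ * w)) := by
  rw [gaussianReal_of_var_ne_zero _ one_ne_zero, gaussianReal_of_var_ne_zero _ one_ne_zero,
    ← withDensity_mul _ (measurable_gaussianPDF _ _) (by fun_prop)]
  congr 1
  ext w
  rw [Pi.mul_apply, gaussianPDF, gaussianPDF, ← ENNReal.ofReal_mul (gaussianPDFReal_nonneg _ _ _),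
    gaussianPDFReal_def, gaussianPDFReal_def]
  congr 1
  simp only
  rw [mul_assoc (√_)⁻¹, ← Real.exp_add]
  congr 2
  push_cast
  ring

lemma lintegral_likelihoodRatio_rpow (μ α : ℝ) :
    ∫⁻ w, ENNReal.ofReal (Real.exp (μ ^ 2 / 2 - μ * w)) ^ α ∂gaussianReal μ 1 =
      ENNReal.ofReal (Real.exp (α * (α - 1) * (μ ^ 2 / 2))) := by
  have h1 : ∀ w : ℝ, ENNReal.ofReal (Real.exp (μ ^ 2 / 2 - μ * w)) ^ α =
      ENNReal.ofReal (Real.exp (α * (μ ^ 2 / 2))) * ENNReal.ofReal (Real.exp (-(α * μ) * w)) := by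
    intro w
    rw [ENNReal.ofReal_rpow_of_pos (Real.exp_pos _), ← Real.exp_mul,
      ← ENNReal.ofReal_mul (Real.exp_pos _).le, ← Real.exp_add]
    congr 2
    ring
  simp_rw [h1]
  rw [lintegral_const_mul _ (by fun_prop), ← ofReal_integral_eq_lintegral_ofReal
    (integrable_exp_mul_gaussianReal _) (ae_of_all _ fun w => (Real.exp_pos _).le)]
  have h2 := congrFun (mgf_id_gaussianReal (μ := μ) (v := 1)) (-(α * μ))
  simp only [mgf, id] at h2
  rw [h2, ← ENNReal.ofReal_mul (Real.exp_pos _).le, ← Real.exp_add]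
  congr 2
  push_cast
  ring

/-- The data processing inequality for the integral that defines the Rényi divergence, at one
outcome: Hölder's inequality for the weight `k`. -/
lemma rpow_lintegral_mul_le {Ω : Type*} [MeasurableSpace Ω] (ν : Measure Ω) {k L : Ω → ℝ≥0∞}
    (hk : Measurable k) (hL : Measurable L) {α : ℝ} (hα : 1 < α) :
    (∫⁻ w, L w * k w ∂ν) ^ α ≤ (∫⁻ w, k w * L w ^ α ∂ν) * (∫⁻ w, k w ∂ν) ^ (α - 1) := by
  have hpq : α.HolderConjugate (Real.conjExponent α) := Real.HolderConjugate.conjExponent hα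
  set q := Real.conjExponent α
  have hα0 : 0 < α := by linarith
  have hq0 : 0 < q := hpq.symm.pos
  have hsum : α⁻¹ + q⁻¹ = 1 := hpq.inv_add_inv_eq_one
  have h := ENNReal.lintegral_mul_le_Lp_mul_Lq ν hpq (f := fun w => k w ^ α⁻¹ * L w)
    (g := fun w => k w ^ q⁻¹) (by fun_prop) (by fun_prop)
  have e1 : ∀ w, ((fun w => k w ^ α⁻¹ * L w) * fun w => k w ^ q⁻¹) w = L w * k w := by
    intro w
    simp only [Pi.mul_apply]
    rw [mul_right_comm, ← ENNReal.rpow_add_of_nonneg _ _ (by positivity) (by positivity), hsum,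
      ENNReal.rpow_one, mul_comm]
  have e2 : ∀ w, (k w ^ α⁻¹ * L w) ^ α = k w * L w ^ α := by
    intro w
    rw [ENNReal.mul_rpow_of_nonneg _ _ hα0.le, ← ENNReal.rpow_mul, inv_mul_cancel₀ hα0.ne',
      ENNReal.rpow_one]
  have e3 : ∀ w, (k w ^ q⁻¹) ^ q = k w := by
    intro w
    rw [← ENNReal.rpow_mul, inv_mul_cancel₀ hq0.ne', ENNReal.rpow_one]
  simp_rw [e1, e2, e3] at h
  refine (ENNReal.rpow_le_rpow h hα0.le).trans (le_of_eq ?_)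
  rw [ENNReal.mul_rpow_of_nonneg _ _ hα0.le, ← ENNReal.rpow_mul, ← ENNReal.rpow_mul,
    one_div, inv_mul_cancel₀ hα0.ne', ENNReal.rpow_one]
  congr 2
  have : q⁻¹ = 1 - α⁻¹ := by linarith
  rw [one_div, this, sub_mul, inv_mul_cancel₀ hα0.ne', one_mul]

/-- Data processing for the Rényi divergence, together with
`D_α(N(0, 1) ‖ N(μ, 1)) = α μ² / 2`. -/
lemma renyiDiv_le_of_kernel {Ω : Type*} [Fintype Ω] [MeasurableSpace Ω]
    [MeasurableSingletonClass Ω] {μ : ℝ} {P Q : PMF Ω} {k : ℝ → Ω → ℝ≥0∞}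
    (hk : ∀ ω, Measurable fun w => k w ω) (hk1 : ∀ w, ∑ ω, k w ω = 1)
    (hP : ∀ ω, P ω = ∫⁻ w, k w ω ∂gaussianReal 0 1)
    (hQ : ∀ ω, Q ω = ∫⁻ w, k w ω ∂gaussianReal μ 1) {α : ℝ} (hα : 1 < α) :
    renyiDiv α P.toMeasure Q.toMeasure ≤ ((μ ^ 2 / 2 * α : ℝ) : EReal) := by
  classical
  set L : ℝ → ℝ≥0∞ := fun w => ENNReal.ofReal (Real.exp (μ ^ 2 / 2 - μ * w)) with hLdef
  have hL : Measurable L := by fun_prop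
  have hPL : ∀ ω, P ω = ∫⁻ w, L w * k w ω ∂gaussianReal μ 1 := by
    intro ω
    rw [hP, gaussianReal_zero_eq_withDensity μ, lintegral_withDensity_eq_lintegral_mul _ hL (hk ω)]
    rfl
  have hzero : ∀ ω, Q ω = 0 → P ω = 0 := by
    intro ω h
    rw [hQ, lintegral_eq_zero_iff (hk ω)] at h
    rw [hPL, lintegral_eq_zero_iff (f := fun w => L w * k w ω) (hL.mul (hk ω))]
    filter_upwards [h] with w hw
    simp only [Pi.zero_apply] at hw ⊢
    rw [hw, mul_zero]
  have hac : P.toMeasure ≪ Q.toMeasure := by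
    intro s hs
    rw [PMF.toMeasure_apply_fintype] at hs ⊢
    rw [Finset.sum_eq_zero_iff] at hs ⊢
    intro ω hω
    have := hs ω hω
    by_cases h : ω ∈ s
    · simp only [Set.indicator_of_mem h] at this ⊢
      exact hzero ω this
    · simp [h]
  have hrn : ∀ ω, P ω = P.toMeasure.rnDeriv Q.toMeasure ω * Q ω := by
    intro ω
    have h := Measure.withDensity_rnDeriv_eq P.toMeasure Q.toMeasure hac
    have h2 := congrArg (fun ν : Measure Ω => ν {ω}) h
    beta_reduce at h2
    rw [withDensity_apply _ (measurableSet_singleton ω), lintegral_singleton,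
      PMF.toMeasure_apply_singleton _ _ (measurableSet_singleton ω),
      PMF.toMeasure_apply_singleton _ _ (measurableSet_singleton ω)] at h2
    exact h2.symm
  have hpt : ∀ ω, P.toMeasure.rnDeriv Q.toMeasure ω ^ α * Q ω ≤
      ∫⁻ w, k w ω * L w ^ α ∂gaussianReal μ 1 := by
    intro ω
    by_cases h0 : Q ω = 0
    · simp [h0]
    have hfin : Q ω ≠ ∞ := Q.apply_ne_top ω
    have hne : Q ω ^ (α - 1) ≠ 0 := by
      rw [Ne, ENNReal.rpow_eq_zero_iff]
      rintro (h | h)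
      · exact h0 h.1
      · exact hfin h.1
    have hne' : Q ω ^ (α - 1) ≠ ∞ := ENNReal.rpow_ne_top_of_nonneg (by linarith) hfin
    refine (ENNReal.mul_le_mul_iff_left hne hne').1 ?_
    have h1 := rpow_lintegral_mul_le (gaussianReal μ 1) (hk ω) hL hα
    rw [← hPL, ← hQ, hrn, ENNReal.mul_rpow_of_nonneg _ _ (by linarith)] at h1
    refine le_trans (le_of_eq ?_) h1
    rw [mul_assoc]
    congr 1
    conv_lhs => rw [← ENNReal.rpow_one (Q ω), ← ENNReal.rpow_mul, one_mul]
    rw [← ENNReal.rpow_add _ _ h0 hfin]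
    congr 1
    ring
  have hI : ∫⁻ ω, P.toMeasure.rnDeriv Q.toMeasure ω ^ α ∂Q.toMeasure ≤
      ENNReal.ofReal (Real.exp (α * (α - 1) * (μ ^ 2 / 2))) := by
    rw [lintegral_fintype, ← lintegral_likelihoodRatio_rpow μ α]
    simp_rw [PMF.toMeasure_apply_singleton _ _ (measurableSet_singleton _)]
    refine (Finset.sum_le_sum fun ω _ => hpt ω).trans (le_of_eq ?_)
    rw [← lintegral_finsetSum (f := fun ω w => k w ω * L w ^ α) _
      fun ω _ => (hk ω).mul (hL.pow_const α)]
    simp_rw [← Finset.sum_mul, hk1, one_mul]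
    rfl
  rw [renyiDiv, if_pos hac]
  have hpos : 0 < α - 1 := by linarith
  have hlog : ENNReal.log (∫⁻ ω, P.toMeasure.rnDeriv Q.toMeasure ω ^ α ∂Q.toMeasure) ≤
      ((α * (α - 1) * (μ ^ 2 / 2) : ℝ) : EReal) := by
    refine (ENNReal.log_monotone hI).trans (le_of_eq ?_)
    rw [ENNReal.log_ofReal, if_neg (not_le.2 (Real.exp_pos _)), Real.log_exp]
  refine (mul_le_mul_of_nonneg_left hlog (EReal.coe_nonneg.2 (inv_nonneg.2 hpos.le))).trans
    (le_of_eq ?_)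
  rw [← EReal.coe_mul]
  congr 1
  field_simp

/-! ### Adaptive composition -/

lemma charFunDual_gaussianReal (m : ℝ) (v : ℝ≥0) (L : StrongDual ℝ ℝ) :
    charFunDual (gaussianReal m v) L =
      Complex.exp (L 1 * m * Complex.I - v * (L 1) ^ 2 / 2) := by
  have hL : ∀ x, L x = L 1 * x := fun x => by
    have := L.map_smul x 1
    simp only [smul_eq_mul, mul_one] at this
    rw [this, mul_comm]
  have : (gaussianReal m v).map L = gaussianReal (L 1 * m) (.mk ((L 1) ^ 2) (sq_nonneg _) * v) := by
    rw [← gaussianReal_map_const_mul]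
    congr 1
    ext x
    exact hL x
  rw [charFunDual_eq_charFun_map_one, this, charFun_gaussianReal]
  congr 1
  simp only [NNReal.coe_mul, NNReal.coe_mk]
  push_cast
  simp
  ring

/-- `N(c(s + t), s + t)`, together with an independent standard Gaussian, is mapped to a pair of
independent Gaussians `N(cs, s)`, `N(ct, t)`. The map does not depend on `c`: the sum is sufficient
for the common drift `c`. -/
lemma exists_gaussian_split (s t : ℝ≥0) (hs : 0 < s) :
    ∃ T : ℝ × ℝ → ℝ × ℝ, Measurable T ∧ ∀ c : ℝ,
      ((gaussianReal (c * (s + t)) (s + t)).prod (gaussianReal 0 1)).map T =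
        (gaussianReal (c * s) s).prod (gaussianReal (c * t) t) := by
  have hst : (0 : ℝ) < s + t := by positivity
  set a : ℝ := s / (s + t)
  set b : ℝ := √(s * t / (s + t))
  have hb : b ^ 2 = s * t / (s + t) := Real.sq_sqrt (by positivity)
  -- Conditionally on the sum `w`, the first summand is `N(s w / (s + t), s t / (s + t))`.
  let T : ℝ × ℝ →L[ℝ] ℝ × ℝ :=
    (a • ContinuousLinearMap.fst ℝ ℝ ℝ + b • ContinuousLinearMap.snd ℝ ℝ ℝ).prod
      ((1 - a) • ContinuousLinearMap.fst ℝ ℝ ℝ - b • ContinuousLinearMap.snd ℝ ℝ ℝ)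
  refine ⟨T, T.measurable, fun c => Measure.ext_of_charFunDual ?_⟩
  ext L
  rw [charFunDual_map, charFunDual_prod, charFunDual_prod]
  simp only [charFunDual_gaussianReal]
  rw [← Complex.exp_add, ← Complex.exp_add]
  set p := L (1, 0)
  set q := L (0, 1)
  have hL : ∀ x y : ℝ, L (x, y) = x * p + y * q := by
    intro x y
    have : ((x, y) : ℝ × ℝ) = x • (1, 0) + y • (0, 1) := by simp
    rw [this, map_add, map_smul, map_smul]
    rfl
  have h1 : (L ∘SL T ∘SL ContinuousLinearMap.inl ℝ ℝ ℝ) 1 = a * p + (1 - a) * q := by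
    simp [T, hL]
  have h2 : (L ∘SL T ∘SL ContinuousLinearMap.inr ℝ ℝ ℝ) 1 = b * p - b * q := by
    simp [T, hL]; ring
  have h3 : (L ∘SL ContinuousLinearMap.inl ℝ ℝ ℝ) 1 = p := by simp [p]
  have h4 : (L ∘SL ContinuousLinearMap.inr ℝ ℝ ℝ) 1 = q := by simp [q]
  rw [ContinuousLinearMap.comp_assoc, ContinuousLinearMap.comp_assoc, h1, h2, h3, h4]
  congr 1
  have ha : a * (s + t) = s := by simp only [a]; field_simp
  have e1 : (a * p + (1 - a) * q) * (c * (s + t)) = p * (c * s) + q * (c * t) := by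
    linear_combination (c * p - c * q) * ha
  have e2 : ((s : ℝ) + t) * (a * p + (1 - a) * q) ^ 2 + (b * p - b * q) ^ 2 =
      s * p ^ 2 + t * q ^ 2 := by
    have : (b * p - b * q) ^ 2 = b ^ 2 * (p - q) ^ 2 := by ring
    rw [this, hb]
    simp only [a]
    field_simp
    ring
  have e1' := congrArg (fun x : ℝ => (x : ℂ)) e1
  have e2' := congrArg (fun x : ℝ => (x : ℂ)) e2
  push_cast at e1' e2' ⊢
  linear_combination Complex.I * e1' - e2' / 2

/-- Adaptive composition: if the first outcome and, for each first outcome, the second one are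
simulable, then so is the second outcome of the two-stage experiment. -/
lemma GaussianSimulable.bind {Ω Ω' : Type*} [Fintype Ω] [Fintype Ω'] {s t : ℝ≥0} (hs : 0 < s)
    {P Q : PMF Ω} (h : GaussianSimulable s P Q) {F G : Ω → PMF Ω'}
    (h' : ∀ b, GaussianSimulable t (F b) (G b)) :
    GaussianSimulable (s + t) (P.bind F) (Q.bind G) := by
  obtain ⟨k, hk, hk1, hP, hQ⟩ := h
  choose l hl hl1 hF hG using h'
  obtain ⟨T, hT, hTc⟩ := exists_gaussian_split s t hs
  have hm : ∀ ω' : Ω', Measurable fun z : ℝ × ℝ => ∑ ω, k z.1 ω * l ω z.2 ω' := fun ω' =>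
    Finset.measurable_sum _ fun ω _ =>
      ((hk ω).comp measurable_fst).mul ((hl ω ω').comp measurable_snd)
  have key : ∀ (c : ℝ) (ω' : Ω'),
      ∫⁻ w, ∫⁻ v, ∑ ω, k (T (w, v)).1 ω * l ω (T (w, v)).2 ω' ∂gaussianReal 0 1
        ∂gaussianReal (c * (s + t)) (s + t) =
      ∑ ω, (∫⁻ w, k w ω ∂gaussianReal (c * s) s) * ∫⁻ w, l ω w ω' ∂gaussianReal (c * t) t := by
    intro c ω'
    rw [← lintegral_prod (fun z => ∑ ω, k (T z).1 ω * l ω (T z).2 ω')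
        ((hm ω').comp hT).aemeasurable,
      ← lintegral_map (f := fun z => ∑ ω, k z.1 ω * l ω z.2 ω') (hm ω') hT, hTc,
      lintegral_finsetSum (f := fun ω (z : ℝ × ℝ) => k z.1 ω * l ω z.2 ω') _ fun ω _ =>
        ((hk ω).comp measurable_fst).mul ((hl ω ω').comp measurable_snd)]
    exact Finset.sum_congr rfl fun ω _ =>
      lintegral_prod_mul (hk ω).aemeasurable (hl ω ω').aemeasurable
  refine ⟨fun w ω' => ∫⁻ v, ∑ ω, k (T (w, v)).1 ω * l ω (T (w, v)).2 ω' ∂gaussianReal 0 1,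
    fun ω' => ((hm ω').comp hT).lintegral_prod_right', fun w => ?_, fun ω' => ?_, fun ω' => ?_⟩
  · rw [← lintegral_finsetSum (f := fun ω' v => ∑ ω, k (T (w, v)).1 ω * l ω (T (w, v)).2 ω') _
      fun ω' _ => ((hm ω').comp hT).comp (measurable_const.prodMk measurable_id)]
    have : ∀ v, ∑ ω', ∑ ω, k (T (w, v)).1 ω * l ω (T (w, v)).2 ω' = 1 := by
      intro v
      rw [Finset.sum_comm]
      simp_rw [← Finset.mul_sum, hl1, mul_one, hk1]
    simp_rw [this]
    simp
  · have := key 0 ω'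
    simp only [zero_mul] at this
    rw [this, PMF.bind_apply, tsum_fintype]
    simp_rw [hP, hF]
  · have := key 1 ω'
    simp only [one_mul] at this
    rw [NNReal.coe_add, this, PMF.bind_apply, tsum_fintype]
    simp_rw [hQ, hG]

lemma GaussianSimulable.const {Ω : Type*} [Fintype Ω] (s : ℝ≥0) (P : PMF Ω) :
    GaussianSimulable s P P :=
  ⟨fun _ => P, fun _ => measurable_const, fun _ => by
    rw [← tsum_fintype (L := .unconditional _), P.tsum_coe], by simp, by simp⟩

/-! ### Noisy threshold queries and decision trees -/

lemma measurable_decide_lt (τ : ℝ) : Measurable fun z : ℝ => decide (τ < z) :=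
  measurable_to_bool (by simpa [Set.preimage, Set.Ioi] using measurableSet_Ioi (a := τ))

/-- The answer to the noisy threshold query `a + N(0, v) > τ`. -/
noncomputable def noisyBit (v : ℝ≥0) (τ a : ℝ) : PMF Bool :=
  haveI : IsProbabilityMeasure ((gaussianReal a v).map fun z => decide (τ < z)) :=
    Measure.isProbabilityMeasure_map
      (measurable_decide_lt τ).aemeasurable
  ((gaussianReal a v).map fun z => decide (τ < z)).toPMF

lemma noisyBit_apply (v : ℝ≥0) (τ a : ℝ) (b : Bool) :
    noisyBit v τ a b = gaussianReal a v {z | decide (τ < z) = b} := by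
  rw [noisyBit, Measure.toPMF_apply, Measure.map_apply (measurable_decide_lt τ)
    (measurableSet_singleton b)]
  rfl

lemma map_gaussianReal_prod (m : ℝ) (v : ℝ≥0) (a c r : ℝ) :
    ((gaussianReal m v).prod (gaussianReal 0 1)).map (fun z => r + (a * z.1 + c * z.2)) =
      gaussianReal (r + a * m) (.mk (a ^ 2) (sq_nonneg a) * v + .mk (c ^ 2) (sq_nonneg c)) := by
  have h := gaussianReal_conv_gaussianReal (m₁ := a * m) (m₂ := c * 0)
    (v₁ := .mk (a ^ 2) (sq_nonneg a) * v)
    (v₂ := .mk (c ^ 2) (sq_nonneg c) * 1)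
  rw [← gaussianReal_map_const_mul, ← gaussianReal_map_const_mul, Measure.conv,
    Measure.map_prod_map _ _ (by fun_prop) (by fun_prop),
    Measure.map_map (by fun_prop) (by fun_prop)] at h
  have h' := congrArg (Measure.map (fun x => r + x)) h
  rw [Measure.map_map (by fun_prop) (by fun_prop), gaussianReal_map_const_add] at h'
  rwa [mul_zero, add_zero, mul_one, add_comm _ r] at h'

/-- Sensitivity-one queries answered with noise of variance `v` cost `v⁻¹`. If the drift of the
query is `d ∈ [-1, 1]`, the fraction `d²` of the noise variance is taken from the given Gaussian
and the rest is added. -/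
lemma GaussianSimulable.noisyBit {v : ℝ≥0} (hv : 0 < v) (τ : ℝ) {a a' : ℝ} (h : |a - a'| ≤ 1) :
    GaussianSimulable v⁻¹ (noisyBit v τ a) (noisyBit v τ a') := by
  set d := a' - a
  have hd : d ^ 2 ≤ 1 := by
    rw [sq_le_one_iff_abs_le_one, abs_sub_comm]
    exact h
  set c := √(v * (1 - d ^ 2))
  have hc : c ^ 2 = v * (1 - d ^ 2) := Real.sq_sqrt (mul_nonneg v.2 (by linarith))
  let f : ℝ × ℝ → ℝ := fun z => a + (v * d * z.1 + c * z.2)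
  have hf : Measurable f := by fun_prop
  have hvar : (.mk ((v * d) ^ 2) (sq_nonneg _) * v⁻¹ + .mk (c ^ 2) (sq_nonneg c) : ℝ≥0) = v := by
    ext
    rw [NNReal.coe_add, NNReal.coe_mul, NNReal.coe_mk, NNReal.coe_mk, hc, NNReal.coe_inv]
    have : (v : ℝ) ≠ 0 := by exact_mod_cast hv.ne'
    field_simp
    ring
  have hlaw : ∀ m, ((gaussianReal m v⁻¹).prod (gaussianReal 0 1)).map f =
      gaussianReal (a + v * d * m) v := by
    intro m
    rw [map_gaussianReal_prod, hvar]
  have hms : ∀ b : Bool, MeasurableSet {z : ℝ | decide (τ < z) = b} := fun b =>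
    measurable_decide_lt τ (measurableSet_singleton b)
  have key : ∀ m b, ∫⁻ w, ∫⁻ u, Set.indicator {z : ℝ | decide (τ < z) = b} 1 (f (w, u))
      ∂gaussianReal 0 1 ∂gaussianReal m v⁻¹ =
      gaussianReal (a + v * d * m) v {z | decide (τ < z) = b} := by
    intro m b
    rw [← hlaw, ← lintegral_indicator_one (hms b), lintegral_map (by
      exact (measurable_one.indicator (hms b))) hf, lintegral_prod
      (fun z => Set.indicator {z : ℝ | decide (τ < z) = b} (1 : ℝ → ℝ≥0∞) (f z))
      ((measurable_one.indicator (hms b)).comp hf).aemeasurable]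
  refine ⟨fun w b => ∫⁻ u, Set.indicator {z : ℝ | decide (τ < z) = b} 1 (f (w, u))
      ∂gaussianReal 0 1, fun b => ?_, fun w => ?_, fun b => ?_, fun b => ?_⟩
  · exact ((measurable_one.indicator (hms b)).comp hf).lintegral_prod_right'
  · rw [← lintegral_finsetSum
      (f := fun b u => Set.indicator {z : ℝ | decide (τ < z) = b} (1 : ℝ → ℝ≥0∞) (f (w, u))) _
      fun b _ => ((measurable_one.indicator (hms b)).comp hf).comp
        (measurable_const.prodMk measurable_id)]
    have : ∀ u, ∑ b : Bool, Set.indicator {z : ℝ | decide (τ < z) = b} (1 : ℝ → ℝ≥0∞)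
        (f (w, u)) = 1 := by
      intro u
      by_cases hu : τ < f (w, u) <;> simp [Set.indicator, hu]
    simp_rw [this]
    simp
  · rw [key, noisyBit_apply, mul_zero, add_zero]
  · rw [key, noisyBit_apply]
    have : (v : ℝ) ≠ 0 := by exact_mod_cast hv.ne'
    have e : a + v * d * ((v⁻¹ : ℝ≥0) : ℝ) = a' := by
      push_cast
      field_simp
      simp only [d]
      ring
    rw [e]

/-- An adaptive sequence of threshold queries, each of them at one of the indices `Fin m`, that
ends in an output in `O`. -/
inductive DecisionTree (m : ℕ) (O : Type*) where
  | leaf (o : O) : DecisionTree m O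
  | node (y : Fin m) (no yes : DecisionTree m O) : DecisionTree m O

namespace DecisionTree

variable {m : ℕ} {O : Type*}

/-- The largest number of queries along a branch. -/
def depth : DecisionTree m O → ℕ
  | leaf _ => 0
  | node _ t₀ t₁ => max t₀.depth t₁.depth + 1

/-- The law of the output if the queries at `y` are answered by independent copies of `p y`. -/
noncomputable def law (p : Fin m → PMF Bool) : DecisionTree m O → PMF O
  | leaf o => PMF.pure o
  | node y t₀ t₁ => (p y).bind fun b => bif b then t₁.law p else t₀.law p

/-- The probability that the output satisfies `bad` if a query at `y` is answered positively with
probability `p y`. -/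
noncomputable def failProb (bad : O → Prop) (p : Fin m → ℝ) : DecisionTree m O → ℝ
  | leaf o => by classical exact if bad o then 1 else 0
  | node y t₀ t₁ => p y * t₁.failProb bad p + (1 - p y) * t₀.failProb bad p

lemma gaussianSimulable_law [Fintype O] {s : ℝ≥0} (hs : 0 < s) {p q : Fin m → PMF Bool}
    (h : ∀ y, GaussianSimulable s (p y) (q y)) (t : DecisionTree m O) (D : ℕ)
    (hD : t.depth ≤ D) : GaussianSimulable (D * s) (t.law p) (t.law q) := by
  induction t generalizing D with
  | leaf o => exact .const _ _
  | node y t₀ t₁ ih₀ ih₁ =>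
    obtain ⟨D, rfl⟩ : ∃ E, D = E + 1 := ⟨D - 1, by simp only [depth] at hD; omega⟩
    simp only [depth, add_le_add_iff_right, max_le_iff] at hD
    have e : ((D + 1 : ℕ) : ℝ≥0) * s = s + D * s := by push_cast; ring
    rw [e]
    refine (h y).bind hs fun b => ?_
    cases b
    · exact ih₀ D hD.1
    · exact ih₁ D hD.2

lemma toReal_toMeasure_law [Fintype O] [MeasurableSpace O] [MeasurableSingletonClass O]
    (p : Fin m → PMF Bool) (bad : O → Prop) (t : DecisionTree m O) :
    (t.law p).toMeasure.real {o | bad o} = t.failProb bad fun y => (p y true).toReal := by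
  classical
  induction t with
  | leaf o =>
    simp only [law, failProb, measureReal_def, PMF.toMeasure_pure]
    rw [Measure.dirac_apply]
    by_cases h : bad o <;> simp [h]
  | node y t₀ t₁ ih₀ ih₁ =>
    simp only [law, failProb]
    rw [measureReal_def, PMF.toMeasure_bind_apply _ _ _ (Set.toFinite _).measurableSet,
      tsum_fintype, Fintype.sum_bool, ENNReal.toReal_add
        (ENNReal.mul_ne_top (PMF.apply_ne_top _ _) (measure_ne_top _ _))
        (ENNReal.mul_ne_top (PMF.apply_ne_top _ _) (measure_ne_top _ _)),
      ENNReal.toReal_mul, ENNReal.toReal_mul]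
    simp only [cond_true, cond_false]
    rw [← measureReal_def, ← measureReal_def, ih₀, ih₁]
    have h1 := (p y).tsum_coe
    rw [tsum_fintype, Fintype.sum_bool] at h1
    have h2 : (p y true).toReal + (p y false).toReal = 1 := by
      rw [← ENNReal.toReal_add (PMF.apply_ne_top _ _) (PMF.apply_ne_top _ _), h1,
        ENNReal.toReal_one]
    rw [← h2]
    ring

end DecisionTree

/-! ### Noisy binary search by multiplicative weights -/

section Search

variable {m : ℕ}

lemma exists_weighted_median (w : Fin (m + 1) → ℝ) (hw : ∀ j, 0 ≤ w j) :
    ∃ k : Fin (m + 1), ∑ j, w j ≤ 2 * ∑ j with j ≤ k, w j ∧ ∑ j, w j ≤ 2 * ∑ j with k ≤ j, w j := by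
  classical
  have hW : 0 ≤ ∑ j, w j := Finset.sum_nonneg fun j _ => hw j
  let S : Finset (Fin (m + 1)) := {k | ∑ j, w j ≤ 2 * ∑ j with j ≤ k, w j}
  have hS : S.Nonempty := ⟨Fin.last m, by
    simp only [S, Finset.mem_filter, Finset.mem_univ, true_and, Fin.le_last, Finset.filter_true]
    linarith⟩
  refine ⟨S.min' hS, (Finset.mem_filter.1 (S.min'_mem hS)).2, ?_⟩
  set k := S.min' hS with hk
  have hsplit := Finset.sum_filter_add_sum_filter_not Finset.univ (fun j => k ≤ j) w
  simp only [not_le] at hsplit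
  rcases Fin.eq_zero_or_eq_succ k with h0 | ⟨l, hl⟩
  · simp only [h0, Fin.zero_le, Finset.filter_true]
    linarith
  · have hlS : l.castSucc ∉ S := fun h => by
      have := S.min'_le _ h
      rw [← hk, hl] at this
      exact absurd this (not_le.2 Fin.castSucc_lt_succ)
    simp only [S, Finset.mem_filter, Finset.mem_univ, true_and, not_le] at hlS
    have : ∀ j : Fin (m + 1), j < k ↔ j ≤ l.castSucc := fun j => by
      rw [hl, Fin.lt_def, Fin.le_def, Fin.val_succ, Fin.val_castSucc, Nat.lt_succ_iff]
    simp only [this] at hsplit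
    linarith

/-- A weighted median of `0, …, m`. -/
noncomputable def weightedMedian (w : Fin (m + 1) → ℝ) : Fin (m + 1) :=
  Classical.epsilon fun k =>
    ∑ j, w j ≤ 2 * ∑ j with j ≤ k, w j ∧ ∑ j, w j ≤ 2 * ∑ j with k ≤ j, w j

lemma weightedMedian_spec (w : Fin (m + 1) → ℝ) (hw : ∀ j, 0 ≤ w j) :
    ∑ j, w j ≤ 2 * ∑ j with j ≤ weightedMedian w, w j ∧
      ∑ j, w j ≤ 2 * ∑ j with weightedMedian w ≤ j, w j :=
  Classical.epsilon_spec (exists_weighted_median w hw)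

/-- The query whether the sought position is at least `k`. For `k = 0` and `k > m` the answer is
known, and no noisy query is made. -/
def ask {O : Type*} (k : ℕ) (no yes : DecisionTree m O) : DecisionTree m O :=
  if k = 0 then yes else if h : k - 1 < m then .node ⟨k - 1, h⟩ no yes else no

/-- The probability of a positive answer in `ask`. -/
noncomputable def askProb (p : Fin m → ℝ) (k : ℕ) : ℝ :=
  if k = 0 then 1 else if h : k - 1 < m then p ⟨k - 1, h⟩ else 0

lemma failProb_ask {O : Type*} (bad : O → Prop) (p : Fin m → ℝ) (k : ℕ)
    (no yes : DecisionTree m O) :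
    (ask k no yes).failProb bad p =
      askProb p k * yes.failProb bad p + (1 - askProb p k) * no.failProb bad p := by
  unfold ask askProb
  split_ifs <;> simp [DecisionTree.failProb]

lemma depth_ask_le {O : Type*} (k : ℕ) (no yes : DecisionTree m O) :
    (ask k no yes).depth ≤ max no.depth yes.depth + 1 := by
  unfold ask
  split_ifs
  · omega
  · simp only [DecisionTree.depth]; omega
  · omega

/-- The factor by which the answer `b` to `ask k` multiplies the weight of the position `j`. -/
noncomputable def gain (k : ℕ) (b : Bool) (j : ℕ) : ℝ := if decide (k ≤ j) = b then 5 / 4 else 1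

lemma gain_pos (k : ℕ) (b : Bool) (j : ℕ) : 0 < gain k b j := by
  unfold gain; split_ifs <;> norm_num

/-- The weights after the answers `b` and `b'` to the queries `k` and `k + 1`. -/
noncomputable def reweight (w : Fin (m + 1) → ℝ) (k : ℕ) (b b' : Bool) (j : Fin (m + 1)) : ℝ :=
  w j * gain k b j * gain (k + 1) b' j

/-- The search with `T` rounds, weights `w` and record `c` of the medians of the earlier rounds. In
each round both sides of the weighted median of `w` are queried; the output is the median of
the recorded medians. -/
noncomputable def search : ℕ → (Fin (m + 1) → ℝ) → (Fin (m + 1) → ℕ) → DecisionTree m (Fin (m + 1))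
  | 0, _, c => .leaf (weightedMedian fun j => (c j : ℝ))
  | T + 1, w, c =>
    let k := weightedMedian w
    let next := fun b b' => search T (reweight w k b b') (c + Pi.single k 1)
    ask k (ask (k + 1) (next false false) (next false true))
      (ask (k + 1) (next true false) (next true true))

lemma depth_search_le (T : ℕ) (w : Fin (m + 1) → ℝ) (c : Fin (m + 1) → ℕ) :
    (search T w c).depth ≤ 2 * T := by
  induction T generalizing w c with
  | zero => simp [search, DecisionTree.depth]
  | succ T ih =>
    simp only [search]
    refine (depth_ask_le _ _ _).trans ?_
    have h := fun b b' => ih (reweight w (weightedMedian w) b b')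
      (c + Pi.single (weightedMedian w) 1)
    have h1 := (depth_ask_le ((weightedMedian w : ℕ) + 1) _ _).trans
      (Nat.add_le_add_right (max_le (h false false) (h false true)) 1)
    have h2 := (depth_ask_le ((weightedMedian w : ℕ) + 1) _ _).trans
      (Nat.add_le_add_right (max_le (h true false) (h true true)) 1)
    omega

/-- The expected factor by which the query `k` changes the weight of `j` relative to the one
of `i`, if the answer is positive with probability `q`. -/
noncomputable def relGain (q : ℝ) (k i j : ℕ) : ℝ :=
  q * (gain k true j / gain k true i) + (1 - q) * (gain k false j / gain k false i)

lemma relGain_nonneg {q : ℝ} (h0 : 0 ≤ q) (h1 : q ≤ 1) (k i j : ℕ) : 0 ≤ relGain q k i j :=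
  add_nonneg (mul_nonneg h0 (div_pos (gain_pos ..) (gain_pos ..)).le)
    (mul_nonneg (by linarith) (div_pos (gain_pos ..) (gain_pos ..)).le)

lemma relGain_of_same_side {q : ℝ} {k i j : ℕ} (h : k ≤ i ↔ k ≤ j) : relGain q k i j = 1 := by
  have : ∀ b, gain k b j / gain k b i = 1 := fun b => by
    have e : gain k b j = gain k b i := by simp only [gain, h]
    rw [e, div_self (gain_pos ..).ne']
  simp [relGain, this]

lemma relGain_of_lt {q : ℝ} {k i j : ℕ} (hi : k ≤ i) (hj : j < k) :
    relGain q k i j = 5 / 4 - 9 / 20 * q := by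
  have hj' : ¬ k ≤ j := by omega
  simp [relGain, gain, hi, hj']
  ring

lemma relGain_of_ge {q : ℝ} {k i j : ℕ} (hi : i < k) (hj : k ≤ j) :
    relGain q k i j = 4 / 5 + 9 / 20 * q := by
  have hi' : ¬ k ≤ i := by omega
  simp [relGain, gain, hj, hi']
  ring

/-- The position `j` lies in the interval `[a, b]`. -/
abbrev Between (a b : ℕ) (j : Fin (m + 1)) : Prop := a ≤ (j : ℕ) ∧ (j : ℕ) ≤ b

/-- The data under which the search is analysed: `π k` is the probability of a positive answer to
`ask k`. The answers never err with probability more than `1/2` about the position `i`, and with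
probability at most `1/10` for queries outside the interval `[a, b]` of acceptable positions. -/
structure AnswerModel (π : ℕ → ℝ) (a b i : ℕ) : Prop where
  nonneg : ∀ k, 0 ≤ π k
  le_one : ∀ k, π k ≤ 1
  lower : a ≤ i
  upper : i ≤ b
  half_le : ∀ k ≤ i, 1 / 2 ≤ π k
  le_half : ∀ k, i < k → π k ≤ 1 / 2
  reliable_low : ∀ k ≤ a, 9 / 10 ≤ π k
  reliable_high : ∀ k, b < k → π k ≤ 1 / 10

namespace AnswerModel

variable {π : ℕ → ℝ} {a b i : ℕ}

lemma relGain_le (h : AnswerModel π a b i) (k j : ℕ) : relGain (π k) k i j ≤ 41 / 40 := by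
  rcases le_or_gt k i with hi | hi <;> rcases le_or_gt k j with hj | hj
  · rw [relGain_of_same_side (by omega)]; norm_num
  · rw [relGain_of_lt hi hj]; linarith [h.half_le k hi]
  · rw [relGain_of_ge hi hj]; linarith [h.le_half k hi]
  · rw [relGain_of_same_side (by omega)]; norm_num

lemma relGain_le_of_reliable (h : AnswerModel π a b i) {k : ℕ} (hk : k ≤ a ∨ b < k) (j : ℕ) :
    relGain (π k) k i j ≤ if (k ≤ i ↔ k ≤ j) then 1 else 169 / 200 := by
  have := h.lower
  have := h.upper
  split_ifs with hs
  · exact (relGain_of_same_side hs).le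
  rcases hk with hk | hk
  · rw [relGain_of_lt (by omega) (by omega)]; linarith [h.reliable_low k hk]
  · rw [relGain_of_ge (by omega) (by omega)]; linarith [h.reliable_high k hk]

/-- A round at an unacceptable median contracts the total weight relative to the weight of `i`:
at least half of the weight lies beyond the median, on the side that does not contain `i`. A round
at an acceptable median increases it only slightly. -/
lemma sum_relGain_le (h : AnswerModel π a b i) (w : Fin (m + 1) → ℝ) (hw : ∀ j, 0 ≤ w j)
    (k : ℕ) (hk : k = weightedMedian w) :
    ∑ j : Fin (m + 1), w j * (relGain (π k) k i j * relGain (π (k + 1)) (k + 1) i j) ≤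
      (if a ≤ k ∧ k ≤ b then 1681 / 1600 else 369 / 400) * ∑ j, w j := by
  have hlo := h.lower
  have hup := h.upper
  have hnn : ∀ k j, 0 ≤ relGain (π k) k i j := fun k j =>
    relGain_nonneg (h.nonneg k) (h.le_one k) k i j
  obtain ⟨hm1, hm2⟩ := weightedMedian_spec w hw
  split_ifs with hgood
  · rw [Finset.mul_sum]
    refine Finset.sum_le_sum fun j _ => ?_
    rw [mul_comm]
    refine mul_le_mul_of_nonneg_right ?_ (hw j)
    refine (mul_le_mul (h.relGain_le k j) (h.relGain_le (k + 1) j) (hnn _ _) (by norm_num)).trans ?_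
    norm_num
  -- `F` is the half of the weight that is contracted.
  have main : ∀ F : Finset (Fin (m + 1)), ∑ j, w j ≤ 2 * ∑ j ∈ F, w j →
      (∀ j : Fin (m + 1), relGain (π k) k i j * relGain (π (k + 1)) (k + 1) i j ≤
        if j ∈ F then 169 / 200 else 1) →
      ∑ j : Fin (m + 1), w j * (relGain (π k) k i j * relGain (π (k + 1)) (k + 1) i j) ≤
        369 / 400 * ∑ j, w j := by
    intro F hF hle
    have h1 : ∑ j : Fin (m + 1), w j * (relGain (π k) k i j * relGain (π (k + 1)) (k + 1) i j) ≤
        ∑ j, (w j - 31 / 200 * if j ∈ F then w j else 0) := by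
      refine Finset.sum_le_sum fun j _ => ?_
      refine (mul_le_mul_of_nonneg_left (hle j) (hw j)).trans (le_of_eq ?_)
      split_ifs <;> ring
    rw [Finset.sum_sub_distrib, ← Finset.mul_sum, Finset.sum_ite_mem, Finset.univ_inter] at h1
    linarith
  have hprod : ∀ {x y u v : ℝ}, 0 ≤ y → x ≤ u → y ≤ v → 0 ≤ u → x * y ≤ u * v := fun hy hx hyv hu =>
    mul_le_mul hx hyv hy hu
  have hr : k + 1 ≤ a ∨ b < k := by omega
  have h1 : ∀ j, relGain (π k) k i j ≤ if (k ≤ i ↔ k ≤ j) then 1 else 169 / 200 :=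
    h.relGain_le_of_reliable (by omega)
  have h2 : ∀ j, relGain (π (k + 1)) (k + 1) i j ≤
      if (k + 1 ≤ i ↔ k + 1 ≤ j) then 1 else 169 / 200 := h.relGain_le_of_reliable (by omega)
  have h1' : ∀ j, relGain (π k) k i j ≤ 1 := fun j => (h1 j).trans (by split_ifs <;> norm_num)
  have h2' : ∀ j, relGain (π (k + 1)) (k + 1) i j ≤ 1 := fun j =>
    (h2 j).trans (by split_ifs <;> norm_num)
  rcases hr with hr | hr
  · refine main {j | j ≤ weightedMedian w} (by simpa using hm1) fun j => ?_
    split_ifs with hj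
    · simp only [Finset.mem_filter, Finset.mem_univ, true_and, Fin.le_def] at hj
      have := h2 j
      rw [if_neg (by omega)] at this
      exact (hprod (hnn _ _) (h1' j) this zero_le_one).trans (by norm_num)
    · exact (hprod (hnn _ _) (h1' j) (h2' j) zero_le_one).trans (by norm_num)
  · refine main {j | weightedMedian w ≤ j} (by simpa using hm2) fun j => ?_
    split_ifs with hj
    · simp only [Finset.mem_filter, Finset.mem_univ, true_and, Fin.le_def] at hj
      have := h1 j
      rw [if_neg (by omega)] at this
      exact (hprod (hnn _ _) this (h2' j) (by norm_num)).trans (by norm_num)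
    · exact (hprod (hnn _ _) (h1' j) (h2' j) zero_le_one).trans (by norm_num)

/-- The potential argument. With `B` unacceptable and `G` acceptable medians recorded so far, the
potential is `(∑ j, w j / w i) λ ^ B λ⁻¹ ^ G` with `λ = 213/200`; it contracts in expectation in
every round, and it is at least `1` if the final output is unacceptable, because then `B ≥ G`. -/
lemma failProb_search_le {p : Fin m → ℝ} (i : Fin (m + 1)) (h : AnswerModel (askProb p) a b i)
    (T : ℕ) (w : Fin (m + 1) → ℝ) (hw : ∀ j, 0 < w j) (c : Fin (m + 1) → ℕ) :
    (search T w c).failProb (fun o => ¬Between a b o) p ≤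
      (∑ j, w j / w i) * (213 / 200) ^ (∑ j with ¬Between a b j, c j) *
        (200 / 213) ^ (∑ j with Between a b j, c j) * (99 / 100) ^ T := by
  classical
  induction T generalizing w c with
  | zero =>
    simp only [search, DecisionTree.failProb, pow_zero, mul_one]
    have hΨ : 1 ≤ ∑ j, w j / w i := by
      rw [← div_self (hw i).ne']
      exact Finset.single_le_sum (f := fun j => w j / w i)
        (fun j _ => (div_pos (hw j) (hw i)).le) (Finset.mem_univ i)
    split_ifs with hbad
    · exact mul_nonneg (mul_nonneg (by linarith) (by positivity)) (by positivity)
    · set o := weightedMedian fun j => (c j : ℝ)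
      obtain ⟨hc1, hc2⟩ := weightedMedian_spec (fun j => (c j : ℝ)) fun j => Nat.cast_nonneg _
      set B := ∑ j with ¬Between a b j, c j
      set G := ∑ j with Between a b j, c j
      have hBG : G + B = ∑ j, c j := Finset.sum_filter_add_sum_filter_not _ _ _
      have hGB : G ≤ B := by
        have hB : ∑ j, c j ≤ 2 * B := by
          rcases not_and_or.1 hbad with ho | ho
          · have : ∑ j with j ≤ o, c j ≤ B := Finset.sum_le_sum_of_subset fun j hj => by
              simp only [Finset.mem_filter, Finset.mem_univ, true_and, Fin.le_def, Between] at hj ⊢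
              omega
            have h3 : ∑ j, c j ≤ 2 * ∑ j with j ≤ o, c j := by exact_mod_cast hc1
            omega
          · have : ∑ j with o ≤ j, c j ≤ B := Finset.sum_le_sum_of_subset fun j hj => by
              simp only [Finset.mem_filter, Finset.mem_univ, true_and, Fin.le_def, Between] at hj ⊢
              omega
            have h3 : ∑ j, c j ≤ 2 * ∑ j with o ≤ j, c j := by exact_mod_cast hc2
            omega
        omega
      obtain ⟨d, hd⟩ := Nat.exists_eq_add_of_le hGB
      have e : (213 / 200 : ℝ) ^ B * (200 / 213) ^ G = (213 / 200) ^ d := by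
        rw [hd, pow_add, mul_right_comm, ← mul_pow]
        norm_num
      rw [mul_assoc, e]
      exact one_le_mul_of_one_le_of_one_le hΨ (one_le_pow₀ (by norm_num))
  | succ T ih =>
    set k := weightedMedian w with hk
    set c' := c + Pi.single k 1
    set q := askProb p k
    set q' := askProb p (k + 1)
    have hq0 : 0 ≤ q := h.nonneg _
    have hq1 : q ≤ 1 := h.le_one _
    have hq0' : 0 ≤ q' := h.nonneg _
    have hq1' : q' ≤ 1 := h.le_one _
    set E := (213 / 200 : ℝ) ^ (∑ j with ¬Between a b j, c' j) *
        (200 / 213) ^ (∑ j with Between a b j, c' j) * (99 / 100) ^ T with hE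
    have hEnn : 0 ≤ E := by positivity
    have hpos : ∀ b b' j, 0 < reweight w k b b' j := fun b b' j =>
      mul_pos (mul_pos (hw j) (gain_pos ..)) (gain_pos ..)
    have ih' : ∀ b₁ b₂, (search T (reweight w k b₁ b₂) c').failProb
        (fun o => ¬Between a b o) p ≤
        (∑ j, reweight w k b₁ b₂ j / reweight w k b₁ b₂ i) * E := fun b₁ b₂ => by
      refine (ih (reweight w k b₁ b₂) (hpos b₁ b₂) c').trans (le_of_eq ?_)
      rw [hE]; ring
    have hstep := h.sum_relGain_le w (fun j => (hw j).le) k rfl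
    have hratio : ∀ b₁ b₂ j, reweight w k b₁ b₂ j / reweight w k b₁ b₂ i =
        w j / w i * ((gain k b₁ j / gain k b₁ i) * (gain (k + 1) b₂ j / gain (k + 1) b₂ i)) := by
      intro b₁ b₂ j
      simp only [reweight]
      rw [mul_div_mul_comm, mul_div_mul_comm, mul_assoc]
    have hmean : q * (q' * (∑ j, reweight w k true true j / reweight w k true true i) +
          (1 - q') * ∑ j, reweight w k true false j / reweight w k true false i) +
        (1 - q) * (q' * (∑ j, reweight w k false true j / reweight w k false true i) +
          (1 - q') * ∑ j, reweight w k false false j / reweight w k false false i) =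
        (∑ j : Fin (m + 1), w j * (relGain q k i j * relGain q' (k + 1) i j)) / w i := by
      simp only [Finset.mul_sum, ← Finset.sum_add_distrib, Finset.sum_div]
      refine Finset.sum_congr rfl fun j _ => ?_
      simp only [hratio, relGain]
      ring
    have hfac : (if Between a b k then 1681 / 1600 else 369 / 400 : ℝ) * E ≤
        (213 / 200) ^ (∑ j with ¬Between a b j, c j) *
        (200 / 213) ^ (∑ j with Between a b j, c j) *
          (99 / 100) ^ (T + 1) := by
      have hsum : ∀ P : Fin (m + 1) → Prop, [DecidablePred P] →
          ∑ j with P j, c' j = ∑ j with P j, c j + if P k then 1 else 0 := by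
        intro P _
        simp only [c', Pi.add_apply, Finset.sum_add_distrib]
        simp
      rw [hE, hsum, hsum, pow_add, pow_add, pow_succ (99 / 100 : ℝ)]
      set X := (213 / 200 : ℝ) ^ (∑ j with ¬Between a b j, c j)
      set Y := (200 / 213 : ℝ) ^ (∑ j with Between a b j, c j)
      set Z := (99 / 100 : ℝ) ^ T
      have hXYZ : 0 ≤ X * Y * Z := by positivity
      by_cases hg : Between a b k
      · rw [if_pos hg, if_pos hg, if_neg (not_not.2 hg)]
        linarith
      · rw [if_neg hg, if_neg hg, if_pos hg]
        linarith
    simp only [search]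
    rw [failProb_ask, failProb_ask, failProb_ask]
    calc _ ≤ q * (q' * ((∑ j, reweight w k true true j / reweight w k true true i) * E) +
          (1 - q') * ((∑ j, reweight w k true false j / reweight w k true false i) * E)) +
        (1 - q) * (q' * ((∑ j, reweight w k false true j / reweight w k false true i) * E) +
          (1 - q') * ((∑ j, reweight w k false false j / reweight w k false false i) * E)) := by
          have := ih' true true
          have := ih' true false
          have := ih' false true
          have := ih' false false
          have h1 : 0 ≤ 1 - q := by linarith
          have h2 : 0 ≤ 1 - q' := by linarith
          gcongr
      _ = (∑ j : Fin (m + 1), w j * (relGain q k i j * relGain q' (k + 1) i j)) / w i * E := by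
          rw [← hmean]; ring
      _ ≤ ((if Between a b k then 1681 / 1600 else 369 / 400) * ∑ j, w j) / w i * E := by
          have := hw i
          gcongr
      _ = (∑ j, w j / w i) *
          ((if Between a b k then 1681 / 1600 else 369 / 400) * E) := by
          rw [← Finset.sum_div]; ring
      _ ≤ _ := by
          refine (mul_le_mul_of_nonneg_left hfac
            (Finset.sum_nonneg fun j _ => (div_pos (hw j) (hw i)).le)).trans (le_of_eq ?_)
          ring

end AnswerModel

end Search

/-! ### Error probabilities of the noisy threshold queries -/

lemma gaussianReal_real_Ici_le {v : ℝ≥0} (hv : 0 < v) {a τ : ℝ} (h : a ≤ τ) :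
    (gaussianReal a v).real (Set.Ici τ) ≤ Real.exp (-(τ - a) ^ 2 / (2 * v)) := by
  have hv' : (0 : ℝ) < v := by exact_mod_cast hv
  have h1 := measure_ge_le_exp_mul_mgf (X := id) (μ := gaussianReal a v) τ
    (div_nonneg (sub_nonneg.2 h) hv'.le) (integrable_exp_mul_gaussianReal ((τ - a) / v))
  rw [mgf_id_gaussianReal, ← Real.exp_add] at h1
  refine h1.trans (le_of_eq ?_)
  congr 1
  field_simp
  ring

lemma gaussianReal_map_reflect (a : ℝ) (v : ℝ≥0) :
    (gaussianReal a v).map (fun z => 2 * a - z) = gaussianReal a v := by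
  rw [gaussianReal_map_const_sub]
  congr 1
  ring

lemma gaussianReal_real_Iic_eq (v : ℝ≥0) (a τ : ℝ) :
    (gaussianReal a v).real (Set.Iic τ) = (gaussianReal a v).real (Set.Ici (2 * a - τ)) := by
  conv_lhs => rw [← gaussianReal_map_reflect a v]
  rw [map_measureReal_apply (by fun_prop) measurableSet_Iic]
  congr 1
  ext z
  simp only [Set.mem_preimage, Set.mem_Iic, Set.mem_Ici]
  constructor <;> intro h <;> linarith

lemma toReal_noisyBit_true (v : ℝ≥0) (τ a : ℝ) :
    (noisyBit v τ a true).toReal = (gaussianReal a v).real (Set.Ioi τ) := by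
  rw [noisyBit_apply, measureReal_def]
  congr 2
  ext z
  simp

lemma one_sub_toReal_noisyBit_true (v : ℝ≥0) (τ a : ℝ) :
    1 - (noisyBit v τ a true).toReal = (gaussianReal a v).real (Set.Iic τ) := by
  rw [toReal_noisyBit_true, ← Set.compl_Iic, probReal_compl_eq_one_sub measurableSet_Iic]
  ring

lemma toReal_noisyBit_true_le {v : ℝ≥0} (hv : 0 < v) {τ a η : ℝ} (hη : 0 ≤ η) (h : a ≤ τ - η) :
    (noisyBit v τ a true).toReal ≤ Real.exp (-η ^ 2 / (2 * v)) := by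
  rw [toReal_noisyBit_true]
  refine (measureReal_mono Set.Ioi_subset_Ici_self).trans
    ((gaussianReal_real_Ici_le hv (by linarith)).trans ?_)
  have : η ^ 2 ≤ (τ - a) ^ 2 := pow_le_pow_left₀ hη (by linarith) 2
  gcongr

lemma one_sub_toReal_noisyBit_true_le {v : ℝ≥0} (hv : 0 < v) {τ a η : ℝ} (hη : 0 ≤ η)
    (h : τ + η ≤ a) : 1 - (noisyBit v τ a true).toReal ≤ Real.exp (-η ^ 2 / (2 * v)) := by
  rw [one_sub_toReal_noisyBit_true, gaussianReal_real_Iic_eq]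
  refine (gaussianReal_real_Ici_le hv (by linarith)).trans ?_
  have : η ^ 2 ≤ (2 * a - τ - a) ^ 2 := pow_le_pow_left₀ hη (by linarith) 2
  gcongr

lemma toReal_noisyBit_true_le_half (v : ℝ≥0) {τ a : ℝ} (h : a ≤ τ) :
    (noisyBit v τ a true).toReal ≤ 1 / 2 := by
  have h1 := one_sub_toReal_noisyBit_true v τ a
  rw [gaussianReal_real_Iic_eq] at h1
  have h2 : (gaussianReal a v).real (Set.Ioi τ) ≤ (gaussianReal a v).real (Set.Ici (2 * a - τ)) :=
    measureReal_mono fun z hz => by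
      simp only [Set.mem_Ioi, Set.mem_Ici] at hz ⊢; linarith
  rw [← toReal_noisyBit_true, ← h1] at h2
  linarith

lemma half_le_toReal_noisyBit_true (v : ℝ≥0) {τ a : ℝ} (h : τ < a) :
    1 / 2 ≤ (noisyBit v τ a true).toReal := by
  have h1 := one_sub_toReal_noisyBit_true v τ a
  rw [gaussianReal_real_Iic_eq] at h1
  have h2 : (gaussianReal a v).real (Set.Ici (2 * a - τ)) ≤ (gaussianReal a v).real (Set.Ioi τ) :=
    measureReal_mono fun z hz => by
      simp only [Set.mem_Ioi, Set.mem_Ici] at hz ⊢; linarith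
  rw [← toReal_noisyBit_true, ← h1] at h2
  linarith

/-! ### Differentially private binary search -/

lemma exists_cut {m : ℕ} (P : Fin m → Prop) (hP : ∀ y y', y ≤ y' → P y' → P y) :
    ∃ i ≤ m, ∀ y : Fin m, (y : ℕ) < i ↔ P y := by
  classical
  have hex : ∃ i, ∀ y : Fin m, i ≤ (y : ℕ) → ¬ P y := ⟨m, fun y hy => by have := y.2; omega⟩
  have hle : Nat.find hex ≤ m := Nat.find_min' hex fun y hy => by have := y.2; omega
  refine ⟨Nat.find hex, hle, fun y => ⟨fun hy => ?_, fun hy => ?_⟩⟩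
  · have := Nat.find_min hex hy
    push Not at this
    obtain ⟨y', hyy', hy'⟩ := this
    exact hP y y' hyy' hy'
  · by_contra hlt
    exact Nat.find_spec hex y (not_lt.1 hlt) hy

/-- The outputs `i` for which `f` crosses the level `τ`, up to `η`, between the indices `i` and
`i + 1`. -/
def goodOutputs {m : ℕ} (f : Fin m → ℝ) (τ η : ℝ) : Set (Fin (m + 1)) :=
  {i | extended f (i + 1) < ((τ + η : ℝ) : EReal) ∧ ((τ - η : ℝ) : EReal) < extended f i}

lemma mem_goodOutputs {m : ℕ} {f : Fin m → ℝ} {τ η : ℝ} {i : Fin (m + 1)}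
    (h1 : ∀ y : Fin m, (y : ℕ) = i → f y < τ + η)
    (h2 : ∀ y : Fin m, (y : ℕ) + 1 = i → τ - η < f y) : i ∈ goodOutputs f τ η := by
  constructor
  · unfold extended
    rw [if_neg (by omega)]
    split_ifs with h
    · exact EReal.coe_lt_coe_iff.2 (h1 _ (by simp))
    · exact EReal.bot_lt_coe _
  · unfold extended
    split_ifs with h0 h
    · exact EReal.coe_lt_top _
    · refine EReal.coe_lt_coe_iff.2 (h2 _ ?_)
      simp only
      omega
    · omega

lemma lt_of_mem_goodOutputs {m : ℕ} {f : Fin m → ℝ} {τ η : ℝ} {i : Fin (m + 1)}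
    (hi : i ∈ goodOutputs f τ η) {y : Fin m} (hy : (y : ℕ) = i) : f y < τ + η := by
  have h := hi.1
  have hlt : (i : ℕ) + 1 - 1 < m := by have := y.2; omega
  have e : (⟨(i : ℕ) + 1 - 1, hlt⟩ : Fin m) = y := Fin.ext (by simp only; omega)
  rw [extended, if_neg (by omega), dif_pos hlt, e] at h
  exact EReal.coe_lt_coe_iff.1 h

lemma gt_of_mem_goodOutputs {m : ℕ} {f : Fin m → ℝ} {τ η : ℝ} {i : Fin (m + 1)}
    (hi : i ∈ goodOutputs f τ η) {y : Fin m} (hy : (y : ℕ) + 1 = i) : τ - η < f y := by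
  have h := hi.2
  have hlt : (i : ℕ) - 1 < m := by have := y.2; omega
  have e : (⟨(i : ℕ) - 1, hlt⟩ : Fin m) = y := Fin.ext (by simp only; omega)
  rw [extended, if_neg (by omega), dif_pos hlt, e] at h
  exact EReal.coe_lt_coe_iff.1 h

lemma exists_answerModel {m : ℕ} {f : Fin m → ℝ} (hf : Antitone f) {v : ℝ≥0} (hv : 0 < v)
    (τ : ℝ) {η : ℝ} (hη : 0 ≤ η) (hexp : Real.exp (-η ^ 2 / (2 * v)) ≤ 1 / 10) :
    ∃ (a b : ℕ) (i : Fin (m + 1)),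
      AnswerModel (askProb fun y => (noisyBit v τ (f y) true).toReal) a b i ∧
      ∀ o, Between a b o → o ∈ goodOutputs f τ η := by
  obtain ⟨a, ham, ha⟩ := exists_cut (fun y => τ + η ≤ f y) fun y y' h h' => h'.trans (hf h)
  obtain ⟨b, hbm, hb⟩ := exists_cut (fun y => τ - η < f y) fun y y' h h' => h'.trans_le (hf h)
  obtain ⟨i, him, hi⟩ := exists_cut (fun y => τ < f y) fun y y' h h' => h'.trans_le (hf h)
  have hai : a ≤ i ∨ η = 0 := by
    by_contra! hcon
    have h1 := (ha ⟨i, by omega⟩).1 hcon.1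
    have h2 := (hi ⟨i, by omega⟩).2 (lt_of_lt_of_le
      (by linarith [lt_of_le_of_ne hη hcon.2.symm]) h1)
    exact lt_irrefl _ h2
  have hη0 : η ≠ 0 := by
    rintro rfl
    norm_num at hexp
  have hpos : ∀ q, 0 ≤ (noisyBit v τ q true).toReal := fun q => ENNReal.toReal_nonneg
  have hle : ∀ q, (noisyBit v τ q true).toReal ≤ 1 := fun q => by
    simpa using ENNReal.toReal_mono ENNReal.one_ne_top ((noisyBit v τ q).coe_le_one true)
  refine ⟨a, b, ⟨i, by omega⟩, ⟨fun k => ?_, fun k => ?_, hai.resolve_right hη0, ?_, fun k hk => ?_,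
    fun k hk => ?_, fun k hk => ?_, fun k hk => ?_⟩, fun o ho => ?_⟩
  · unfold askProb
    split_ifs
    exacts [zero_le_one, hpos _, le_rfl]
  · unfold askProb
    split_ifs
    exacts [le_rfl, hle _, zero_le_one]
  · by_contra! hcon
    simp only at hcon
    have h1 := (hi ⟨b, by omega⟩).1 hcon
    have h2 := (hb ⟨b, by omega⟩).2 (by linarith)
    exact lt_irrefl _ h2
  · unfold askProb
    simp only at hk
    split_ifs with h0 h
    · norm_num
    · exact half_le_toReal_noisyBit_true v ((hi ⟨k - 1, h⟩).1 (by simp only; omega))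
    · omega
  · unfold askProb
    simp only at hk
    split_ifs with h0 h
    · omega
    · exact toReal_noisyBit_true_le_half v
        (not_lt.1 fun hlt => by have := (hi ⟨k - 1, h⟩).2 hlt; simp only at this; omega)
    · norm_num
  · unfold askProb
    split_ifs with h0 h
    · norm_num
    · have := one_sub_toReal_noisyBit_true_le hv hη ((ha ⟨k - 1, h⟩).1 (by simp only; omega))
      linarith
    · omega
  · unfold askProb
    split_ifs with h0 h
    · omega
    · exact (toReal_noisyBit_true_le hv hη
        (not_lt.1 fun hlt => by have := (hb ⟨k - 1, h⟩).2 hlt; simp only at this; omega)).trans hexp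
    · norm_num
  · refine mem_goodOutputs (fun y hy => not_le.1 fun hcon => ?_) fun y hy => (hb y).1 ?_
    · have := (ha y).2 hcon
      have := ho.1
      omega
    · have := ho.2
      omega

/-- The law of the output of the decision tree `t` with noise of variance `D / (2 ρ)` in each
query: if `t` makes at most `D` queries, this is the privacy budget `ρ`. -/
noncomputable def privateLaw {m : ℕ} {O : Type*} (t : DecisionTree m O) (D : ℕ) (ρ : ℝ≥0) (τ : ℝ)
    (f : Fin m → ℝ) : PMF O :=
  t.law fun y => noisyBit (D / (2 * ρ)) τ (f y)

lemma gaussianSimulable_privateLaw {m : ℕ} {O : Type*} [Fintype O] {t : DecisionTree m O} {D : ℕ}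
    (hD : 0 < D) (ht : t.depth ≤ D) {ρ : ℝ≥0} (hρ : 0 < ρ) (τ : ℝ) {f f' : Fin m → ℝ}
    (h : ∀ y, |f y - f' y| ≤ 1) :
    GaussianSimulable (2 * ρ) (privateLaw t D ρ τ f) (privateLaw t D ρ τ f') := by
  have hD' : (0 : ℝ≥0) < D := by exact_mod_cast hD
  have hv : 0 < (D : ℝ≥0) / (2 * ρ) := by positivity
  have := t.gaussianSimulable_law (inv_pos.2 hv) (fun y => GaussianSimulable.noisyBit hv τ (h y)) D ht
  have e : (D : ℝ≥0) * ((D : ℝ≥0) / (2 * ρ))⁻¹ = 2 * ρ := by field_simp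
  rwa [e] at this

lemma one_sub_failProb_le {m : ℕ} {O : Type*} [Fintype O] [MeasurableSpace O]
    [MeasurableSingletonClass O] (t : DecisionTree m O) (D : ℕ) (ρ : ℝ≥0) (τ : ℝ) (f : Fin m → ℝ)
    {bad : O → Prop} {S : Set O} (h : ∀ o, ¬ bad o → o ∈ S) {β : ℝ}
    (hβ : t.failProb bad (fun y => (noisyBit (D / (2 * ρ)) τ (f y) true).toReal) ≤ β) :
    1 - β ≤ (privateLaw t D ρ τ f).toMeasure.real S := by
  rw [← DecisionTree.toReal_toMeasure_law (fun y => noisyBit (D / (2 * ρ)) τ (f y))] at hβ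
  have h1 := probReal_compl_eq_one_sub (μ := (privateLaw t D ρ τ f).toMeasure)
    (Set.toFinite {o | bad o}).measurableSet
  have h2 : (privateLaw t D ρ τ f).toMeasure.real {o | bad o}ᶜ ≤
      (privateLaw t D ρ τ f).toMeasure.real S := measureReal_mono fun o ho => h o ho
  rw [h1] at h2
  unfold privateLaw at *
  linarith

/-- Private binary search as a map `F` from the list `f` of the values of the loss to the law of the
output. The constant `43` is not optimised. -/
theorem exists_private_search (m : ℕ) {ρ : ℝ≥0} {β : ℝ} (hρ : 0 < ρ) (hβ : 0 < β) :
    ∃ η : ℝ, 0 ≤ η ∧ η ≤ 43 * √(Real.log (m / β) / ρ) ∧ ∀ τ : ℝ,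
      ∃ F : (Fin m → ℝ) → PMF (Fin (m + 1)),
        (∀ f f', (∀ y, |f y - f' y| ≤ 1) → GaussianSimulable (2 * ρ) (F f) (F f')) ∧
        ∀ f, Antitone f → 1 - β ≤ (F f).toMeasure.real (goodOutputs f τ η) := by
  have hρ' : (0 : ℝ) < ρ := by exact_mod_cast hρ
  rcases le_or_gt 1 β with hβ1 | hβ1
  · exact ⟨0, le_rfl, by positivity, fun τ => ⟨fun _ => PMF.pure 0, fun _ _ _ => .const _ _,
      fun f _ => (sub_nonpos.2 hβ1).trans measureReal_nonneg⟩⟩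
  obtain rfl | rfl | hm : m = 0 ∨ m = 1 ∨ 2 ≤ m := by omega
  · refine ⟨0, le_rfl, by positivity, fun τ => ⟨fun _ => PMF.pure 0, fun _ _ _ => .const _ _,
      fun f _ => ?_⟩⟩
    have : goodOutputs f τ 0 = Set.univ := Set.eq_univ_of_forall fun i =>
      mem_goodOutputs (fun y => y.elim0) fun y => y.elim0
    rw [this, probReal_univ]
    linarith
  · -- A single query. The threshold tends to zero as `β` tends to one.
    have hlog : 0 < Real.log (1 / β) := Real.log_pos (by rw [lt_div_iff₀ hβ]; linarith)
    refine ⟨√(Real.log (1 / β) / ρ), Real.sqrt_nonneg _, ?_, fun τ =>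
      ⟨privateLaw (.node 0 (.leaf 0) (.leaf 1)) 1 ρ τ, fun f f' h =>
        gaussianSimulable_privateLaw one_pos (by simp [DecisionTree.depth]) hρ τ h, fun f _ => ?_⟩⟩
    · rw [Nat.cast_one]
      linarith [Real.sqrt_nonneg (Real.log (1 / β) / ρ)]
    set η := √(Real.log (1 / β) / ρ)
    have hη : 0 < η := Real.sqrt_pos.2 (by positivity)
    have hv : 0 < ((1 : ℕ) : ℝ≥0) / (2 * ρ) := by positivity
    have hexp : Real.exp (-η ^ 2 / (2 * (((1 : ℕ) : ℝ≥0) / (2 * ρ) : ℝ≥0))) = β := by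
      have : η ^ 2 = Real.log (1 / β) / ρ := Real.sq_sqrt (by positivity)
      rw [this]
      push_cast
      have : -(Real.log (1 / β) / ρ) / (2 * (1 / (2 * ρ))) = Real.log β := by
        rw [one_div, Real.log_inv]
        field_simp
      rw [this, Real.exp_log hβ]
    refine one_sub_failProb_le _ _ _ _ _ (bad := fun o => o ∉ goodOutputs f τ η)
      (fun o ho => not_not.1 ho) ?_
    have hg0 : f 0 < τ + η → (0 : Fin 2) ∈ goodOutputs f τ η := fun h =>
      mem_goodOutputs (fun y _ => by rwa [Subsingleton.elim y 0]) fun y hy => by simp at hy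
    have hg1 : τ - η < f 0 → (1 : Fin 2) ∈ goodOutputs f τ η := fun h =>
      mem_goodOutputs (fun y hy => by simp at hy)
        fun y _ => by rwa [Subsingleton.elim y 0]
    simp only [DecisionTree.failProb]
    rcases le_or_gt (τ + η) (f 0) with h1 | h1
    · have := one_sub_toReal_noisyBit_true_le hv hη.le h1
      rw [hexp] at this
      have h2 := hg1 (by linarith)
      simp only [h2, not_true_eq_false, if_false, mul_zero, zero_add]
      split_ifs <;> linarith
    · have h2 := hg0 h1
      rcases le_or_gt (f 0) (τ - η) with h3 | h3
      · have := toReal_noisyBit_true_le hv hη.le h3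
        rw [hexp] at this
        simp only [h2, not_true_eq_false, if_false, mul_zero, add_zero]
        split_ifs <;> linarith
      · simp only [h2, hg1 h3, not_true_eq_false, if_false, mul_zero, add_zero]
        exact hβ.le
  -- Below, `T` is the number of rounds, so that `(m + 1) (99/100) ^ T ≤ β`.
  set L := Real.log (m / β)
  have hm' : (2 : ℝ) ≤ m := by exact_mod_cast hm
  have hL : 1 / 2 ≤ L := by
    have h2 : Real.log 2 ≤ L := Real.log_le_log (by norm_num) (by rw [le_div_iff₀ hβ]; nlinarith)
    linarith [Real.log_two_gt_d9]
  have hL2 : Real.log ((m + 1) / β) ≤ 2 * L := by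
    have : 2 * L = Real.log ((m / β) ^ 2) := by rw [Real.log_pow]; norm_num [L]
    rw [this]
    refine Real.log_le_log (by positivity) ?_
    rw [div_pow, div_le_div_iff₀ hβ (by positivity)]
    have h1 : ((m : ℝ) + 1) * β ≤ m ^ 2 := by nlinarith
    nlinarith
  set T := ⌈100 * Real.log ((m + 1) / β)⌉₊
  have hT0 : 0 < T := Nat.ceil_pos.2 (mul_pos (by norm_num) (Real.log_pos (by
    rw [lt_div_iff₀ hβ]; linarith)))
  have hT1 : 100 * Real.log ((m + 1) / β) ≤ T := Nat.le_ceil _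
  have hT2 : (T : ℝ) ≤ 202 * L := by
    have : (T : ℝ) < 100 * Real.log ((m + 1) / β) + 1 := Nat.ceil_lt_add_one (by
      refine mul_nonneg (by norm_num) (Real.log_nonneg ?_)
      rw [le_div_iff₀ hβ]; linarith)
    linarith
  have hTpow : ((m : ℝ) + 1) * (99 / 100) ^ T ≤ β := by
    have h1 : (99 / 100 : ℝ) ^ T ≤ Real.exp (-Real.log ((m + 1) / β)) := by
      have h2 : (99 / 100 : ℝ) ≤ Real.exp (-(1 / 100)) := by
        linarith [Real.add_one_le_exp (-(1 / 100) : ℝ)]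
      refine (pow_le_pow_left₀ (by norm_num) h2 T).trans ?_
      rw [← Real.exp_nat_mul]
      exact Real.exp_le_exp.2 (by linarith)
    rw [Real.exp_neg, Real.exp_log (by positivity), inv_div] at h1
    calc ((m : ℝ) + 1) * (99 / 100) ^ T ≤ ((m : ℝ) + 1) * (β / (m + 1)) := by gcongr
      _ = β := by field_simp
  have hT0' : (0 : ℝ≥0) < T := by exact_mod_cast hT0
  set v : ℝ≥0 := ((2 * T : ℕ) : ℝ≥0) / (2 * ρ) with hvdef
  have hvT : (v : ℝ) = T / ρ := by
    rw [hvdef]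
    push_cast
    field_simp
  have hv : 0 < v := by rw [hvdef]; push_cast; positivity
  have hv' : (0 : ℝ) < v := by exact_mod_cast hv
  -- Three standard deviations make the error probability at most `exp (-9/2) ≤ 1/10`.
  refine ⟨3 * √v, by positivity, ?_, fun τ =>
    ⟨privateLaw (search T (fun _ => 1) fun _ => 0) (2 * T) ρ τ, fun f f' h =>
      gaussianSimulable_privateLaw (by omega) (depth_search_le _ _ _) hρ τ h, fun f hf => ?_⟩⟩
  · have : √(v : ℝ) ≤ √(205 * (L / ρ)) := by
      apply Real.sqrt_le_sqrt
      rw [hvT, ← mul_div_assoc]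
      gcongr
      linarith
    have h205 : √(205 : ℝ) ≤ 43 / 3 := Real.sqrt_le_iff.2 ⟨by norm_num, by norm_num⟩
    rw [Real.sqrt_mul (by norm_num)] at this
    have := mul_le_mul_of_nonneg_right h205 (Real.sqrt_nonneg (L / ρ))
    linarith
  · have hexp : Real.exp (-(3 * √(v : ℝ)) ^ 2 / (2 * v)) ≤ 1 / 10 := by
      rw [mul_pow, Real.sq_sqrt hv'.le]
      have e : -(3 ^ 2 * (v : ℝ)) / (2 * v) = -(9 / 2) := by field_simp; norm_num
      rw [e, Real.exp_neg, one_div]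
      refine inv_anti₀ (by norm_num) ?_
      have h3 : Real.exp (3 : ℝ) = Real.exp 1 ^ 3 := by rw [← Real.exp_nat_mul]; norm_num
      have h4 : Real.exp 3 ≤ Real.exp (9 / 2) := Real.exp_le_exp.2 (by norm_num)
      have h5 : (2.7 : ℝ) ^ 3 ≤ Real.exp 1 ^ 3 :=
        pow_le_pow_left₀ (by norm_num) (by linarith [Real.exp_one_gt_d9]) 3
      norm_num at h5
      linarith
    obtain ⟨a, b, i, hmodel, hgood⟩ := exists_answerModel hf hv τ (by positivity) hexp
    refine one_sub_failProb_le _ _ _ _ _ (fun o ho => hgood o (not_not.1 ho)) ?_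
    refine (hmodel.failProb_search_le i T (fun _ => 1) (fun _ => one_pos) fun _ => 0).trans ?_
    simpa using hTpow

/-! ### The shifted inverse loss -/

section Loss

variable {𝒳 : Type u} [Bot 𝒳] {n : ℕ}

lemma shiftedInverseLoss_le {g : Dataset 𝒳 → ℝ} {x x' : Fin n → 𝒳} {y : ℝ} (hx : IsSub x' x)
    (hy : g ⟨n, x'⟩ ≤ y) : shiftedInverseLoss g x y ≤ size (diff x x') :=
  sInf_le ⟨x', hx, hy, rfl⟩

/-- The minimum in the definition of the loss is attained if the loss is finite. -/
lemma exists_of_shiftedInverseLoss_ne_top {g : Dataset 𝒳 → ℝ} {x : Fin n → 𝒳} {y : ℝ}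
    (h : shiftedInverseLoss g x y ≠ ⊤) :
    ∃ x', IsSub x' x ∧ g ⟨n, x'⟩ ≤ y ∧ shiftedInverseLoss g x y = size (diff x x') := by
  refine csInf_mem (s := {v : ℕ∞ | ∃ x' : Fin n → 𝒳, IsSub x' x ∧ g ⟨n, x'⟩ ≤ y ∧
    v = (size (diff x x') : ℕ∞)}) ?_
  by_contra hempty
  rw [Set.not_nonempty_iff_eq_empty] at hempty
  exact h (by rw [shiftedInverseLoss, hempty, sInf_empty])

lemma antitone_shiftedInverseLoss (g : Dataset 𝒳 → ℝ) (x : Fin n → 𝒳) :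
    Antitone (shiftedInverseLoss g x) := fun _ _ hyy' =>
  sInf_le_sInf fun _ ⟨x', hx', hy, hv⟩ => ⟨x', hx', hy.trans hyy', hv⟩

lemma isSub_bot (x : Fin n → 𝒳) : IsSub (fun _ => ⊥) x := fun _ => Or.inr rfl

lemma shiftedInverseLoss_ne_top {g : Dataset 𝒳 → ℝ} (x : Fin n → 𝒳) {y : ℝ}
    (hy : g ⟨n, fun _ => ⊥⟩ ≤ y) : shiftedInverseLoss g x y ≠ ⊤ :=
  ne_top_of_le_ne_top (ENat.natCast_ne_top _) (shiftedInverseLoss_le (isSub_bot x) hy)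

/-- The loss has sensitivity one: an optimal subset of `x'`, restricted to the positions where it
agrees with `x`, is a subset of `x` which misses at most `|x \ x'|` further entries. -/
lemma shiftedInverseLoss_le_add {g : Dataset 𝒳 → ℝ} (hg : SubsetMonotone g) (x x' : Fin n → 𝒳)
    (y : ℝ) : shiftedInverseLoss g x y ≤ shiftedInverseLoss g x' y + tupleDist x x' := by
  classical
  by_cases htop : shiftedInverseLoss g x' y = ⊤
  · simp [htop]
  obtain ⟨z', hz', hzy, hz⟩ := exists_of_shiftedInverseLoss_ne_top htop
  let z : Fin n → 𝒳 := fun i => if z' i = x i then z' i else ⊥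
  have hzx : IsSub z x := fun i => by
    by_cases h : z' i = x i <;> simp [z, h]
  have hzz' : IsSub z z' := fun i => by
    by_cases h : z' i = x i <;> simp [z, h]
  refine (shiftedInverseLoss_le hzx ((hg n z z' hzz').trans hzy)).trans ?_
  rw [hz]
  have hsub : {i | diff x z i ≠ ⊥} ⊆ {i | diff x' z' i ≠ ⊥} ∪ {i | diff x x' i ≠ ⊥} := by
    intro i hi
    simp only [Set.mem_ofPred_eq, Set.mem_union, diff, z] at hi ⊢
    by_cases h1 : x i = x' i
    · left
      by_cases h2 : z' i = x i
      · simp [h2] at hi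
      · rw [← h1, if_neg (fun h => h2 h.symm)]
        intro h3
        simp [h3] at hi
    · right
      rw [if_neg h1]
      intro h3
      simp [h3] at hi
  have hle : size (diff x z) ≤ size (diff x' z') + tupleDist x x' :=
    (Set.ncard_le_ncard hsub).trans ((Set.ncard_union_le _ _).trans
      (Nat.add_le_add_left (Nat.le_add_right _ _) _))
  exact_mod_cast hle

lemma tupleDist_comm (x x' : Fin n → 𝒳) : tupleDist x x' = tupleDist x' x := Nat.add_comm _ _

/-- The loss computed from the table of the values of `g` on the subsets of the input: the
least number of removed indices. -/
noncomputable def tableLoss (v : Finset (Fin n) → ℝ) (y : ℝ) : ℕ∞ :=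
  sInf {k : ℕ∞ | ∃ S : Finset (Fin n), v S ≤ y ∧ k = (Sᶜ.card : ℕ∞)}

lemma shiftedInverseLoss_eq_tableLoss (g : Dataset 𝒳 → ℝ) (x : Fin n → 𝒳) (y : ℝ) :
    shiftedInverseLoss g x y = tableLoss (subsetValues g x) y := by
  classical
  apply le_antisymm
  · refine le_sInf ?_
    rintro _ ⟨S, hS, rfl⟩
    have hx : IsSub (restrict x S) x := fun i => by
      by_cases h : i ∈ S <;> simp [restrict, h]
    refine (shiftedInverseLoss_le hx hS).trans ?_
    have hsub : {i | diff x (restrict x S) i ≠ ⊥} ⊆ (Sᶜ : Finset (Fin n)) := by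
      intro i hi
      simp only [Set.mem_ofPred_eq, diff, restrict] at hi
      simp only [Finset.coe_compl, Set.mem_compl_iff, Finset.mem_coe]
      intro h
      simp [h] at hi
    have := Set.ncard_le_ncard hsub (Set.toFinite _)
    rw [Set.ncard_coe_finset] at this
    exact_mod_cast this
  · refine le_sInf ?_
    rintro _ ⟨x', hx', hy, rfl⟩
    let S : Finset (Fin n) := {i | x' i = x i}
    have hres : restrict x S = x' := by
      funext i
      by_cases h : x' i = x i
      · simp [restrict, S, h]
      · have hiS : i ∉ S := by simpa [S] using h
        rw [restrict, if_neg hiS, (hx' i).resolve_left h]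
    have hset : {i | diff x x' i ≠ ⊥} = (Sᶜ : Finset (Fin n)) := by
      ext i
      simp only [Set.mem_ofPred_eq, diff, Finset.coe_compl, Set.mem_compl_iff, Finset.mem_coe, S,
        Finset.mem_filter, Finset.mem_univ, true_and]
      by_cases h : x' i = x i
      · simp [h]
      · have hb := (hx' i).resolve_left h
        rw [if_neg (fun h' => h h'.symm)]
        simp only [h, not_false_eq_true, iff_true]
        exact fun h' => h (hb.trans h'.symm)
    refine sInf_le ⟨S, by rwa [subsetValues, hres], ?_⟩
    rw [size, hset, Set.ncard_coe_finset]

lemma size_eq_card [DecidableEq 𝒳] (x : Fin n → 𝒳) : size x = ∑ i, if x i ≠ ⊥ then 1 else 0 := by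
  rw [size, Set.ncard_eq_toFinset_card', Finset.sum_boole]
  simp

lemma size_insertNth_bot (x : Fin n → 𝒳) (i : Fin (n + 1)) :
    size (Fin.insertNth (α := fun _ => 𝒳) i ⊥ x) = size x := by
  classical
  rw [size_eq_card, size_eq_card, Fin.sum_univ_succAbove _ i]
  simp

lemma diff_insertNth_bot (x x' : Fin n → 𝒳) (i : Fin (n + 1)) :
    diff (Fin.insertNth (α := fun _ => 𝒳) i ⊥ x) (Fin.insertNth (α := fun _ => 𝒳) i ⊥ x') =
      Fin.insertNth (α := fun _ => 𝒳) i ⊥ (diff x x') := by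
  funext j
  rcases Fin.eq_self_or_eq_succAbove i j with rfl | ⟨k, rfl⟩
  · simp [diff]
  · unfold diff
    rw [Fin.insertNth_apply_succAbove, Fin.insertNth_apply_succAbove,
      Fin.insertNth_apply_succAbove]

lemma isSub_insertNth_bot_iff (x : Fin n → 𝒳) (i : Fin (n + 1)) (z : Fin (n + 1) → 𝒳) :
    IsSub z (Fin.insertNth (α := fun _ => 𝒳) i ⊥ x) ↔
      ∃ x', IsSub x' x ∧ z = Fin.insertNth (α := fun _ => 𝒳) i ⊥ x' := by
  constructor
  · intro h
    refine ⟨i.removeNth z, fun j => by simpa [Fin.removeNth] using h (i.succAbove j), ?_⟩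
    have hi : z i = ⊥ := by simpa using h i
    rw [← hi]
    exact (Fin.insertNth_self_removeNth i z).symm
  · rintro ⟨x', hx', rfl⟩ j
    rcases Fin.eq_self_or_eq_succAbove i j with rfl | ⟨k, rfl⟩
    · simp
    · simpa using hx' k

lemma shiftedInverseLoss_insertNth_bot {g : Dataset 𝒳 → ℝ} (hg : NullInvariant g)
    (x : Fin n → 𝒳) (i : Fin (n + 1)) (y : ℝ) :
    shiftedInverseLoss g (Fin.insertNth (α := fun _ => 𝒳) i ⊥ x) y = shiftedInverseLoss g x y := by
  unfold shiftedInverseLoss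
  congr 1
  ext v
  simp only [Set.mem_ofPred_eq, isSub_insertNth_bot_iff]
  constructor
  · rintro ⟨_, ⟨x', hx', rfl⟩, hy, rfl⟩
    exact ⟨x', hx', by rwa [hg n x' i] at hy, by rw [diff_insertNth_bot, size_insertNth_bot]⟩
  · rintro ⟨x', hx', hy, rfl⟩
    exact ⟨_, ⟨x', hx', rfl⟩, by rwa [hg n x' i], by rw [diff_insertNth_bot, size_insertNth_bot]⟩

lemma size_eq_size_add_size_diff {x x' : Fin n → 𝒳} (h : IsSub x' x) :
    size x = size x' + size (diff x x') := by
  classical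
  rw [size_eq_card, size_eq_card, size_eq_card, ← Finset.sum_add_distrib]
  refine Finset.sum_congr rfl fun i _ => ?_
  rcases h i with h | h
  · simp [diff, h]
  · by_cases hx : x i = ⊥ <;> simp [diff, h, hx]

/-- The real number `min (ℓ, K)`, for a loss `ℓ` that may be infinite. -/
noncomputable def truncate (K : ℝ) (l : ℕ∞) : ℝ := if l = ⊤ then K else min l.toNat K

lemma truncate_le_truncate {K : ℝ} {l l' : ℕ∞} (h : l ≤ l') : truncate K l ≤ truncate K l' := by
  unfold truncate
  split_ifs with h1 h2 h2
  · exact le_rfl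
  · exact absurd (top_le_iff.1 (h1 ▸ h)) h2
  · exact min_le_right _ _
  · have : l.toNat ≤ l'.toNat := ENat.toNat_le_toNat h h2
    gcongr

/-- No lower bound on the level `y` is needed after truncation: if there is no subset of `x`
with `g ≤ y`, then there is none for `x'` either, and both losses are infinite. -/
lemma abs_truncate_sub_truncate_le {g : Dataset 𝒳 → ℝ} (hg : SubsetMonotone g) (K : ℝ)
    (x x' : Fin n → 𝒳) (y : ℝ) :
    |truncate K (shiftedInverseLoss g x y) - truncate K (shiftedInverseLoss g x' y)| ≤
      tupleDist x x' := by
  have key : ∀ x x' : Fin n → 𝒳, truncate K (shiftedInverseLoss g x y) ≤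
      truncate K (shiftedInverseLoss g x' y) + tupleDist x x' := by
    intro x x'
    have hle := shiftedInverseLoss_le_add hg x x' y
    have hd : (0 : ℝ) ≤ tupleDist x x' := Nat.cast_nonneg _
    unfold truncate
    split_ifs with h1 h2 h2
    · linarith
    · rw [h1, top_le_iff] at hle
      exact absurd hle (WithTop.add_ne_top.2 ⟨h2, ENat.natCast_ne_top _⟩)
    · exact (min_le_right _ _).trans (by linarith)
    · obtain ⟨l, hl⟩ := ENat.ne_top_iff_exists.1 h1
      obtain ⟨l', hl'⟩ := ENat.ne_top_iff_exists.1 h2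
      rw [← hl, ← hl'] at hle ⊢
      have hle' : (l : ℝ) ≤ l' + tupleDist x x' := by exact_mod_cast hle
      rw [ENat.toNat_natCast, ENat.toNat_natCast, ← min_add_add_right]
      exact min_le_min hle' (by linarith)
  rw [abs_sub_le_iff]
  have h1 := key x x'
  have h2 := key x' x
  rw [tupleDist_comm x' x] at h2
  constructor <;> linarith

end Loss

/-! ### The mechanisms -/

/-- The randomised algorithm whose output on `x` has the law `P x`. -/
noncomputable def toAlgorithm {𝒳 : Type u} {Ω : Type*} [MeasurableSpace Ω]
    (P : Dataset 𝒳 → PMF Ω) (x : Dataset 𝒳) : ProbabilityMeasure Ω :=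
  ⟨(P x).toMeasure, inferInstance⟩

lemma toAlgorithm_eq {𝒳 : Type u} {Ω : Type*} [MeasurableSpace Ω] {P : Dataset 𝒳 → PMF Ω}
    {x x' : Dataset 𝒳} (h : P x = P x') : toAlgorithm P x = toAlgorithm P x' :=
  Subtype.ext (congrArg (fun p : PMF Ω => p.toMeasure) h)

section Privacy

variable {𝒳 : Type u} [Bot 𝒳] {Ω : Type*} [Fintype Ω] [MeasurableSpace Ω]
  [MeasurableSingletonClass Ω] {ρ : ℝ≥0} {P : Dataset 𝒳 → PMF Ω}

lemma isZCDP_toAlgorithm (h : ∀ (n : ℕ) (x x' : Fin n → 𝒳), Neighbouring x x' →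
    GaussianSimulable (2 * ρ) (P ⟨n, x⟩) (P ⟨n, x'⟩)) : IsZCDP ρ (toAlgorithm P) := by
  intro n x x' hxx' α hα
  obtain ⟨k, hk, hk1, hP, hQ⟩ := (h n x x' hxx').exists_kernel
  have := renyiDiv_le_of_kernel hk hk1 hP hQ hα
  rw [Real.sq_sqrt (NNReal.coe_nonneg _)] at this
  have e : ((2 * ρ : ℝ≥0) : ℝ) / 2 = ρ := by push_cast; ring
  rwa [e] at this

lemma isGDP_toAlgorithm (h : ∀ (n : ℕ) (x x' : Fin n → 𝒳), Neighbouring x x' →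
    GaussianSimulable (2 * ρ) (P ⟨n, x⟩) (P ⟨n, x'⟩)) : IsGDP √(2 * ρ) (toAlgorithm P) := by
  intro n x x' hxx' a ha _
  obtain ⟨k, hk, hk1, hP, hQ⟩ := (h n x x' hxx').exists_kernel
  exact tradeoff_le_of_kernel hk hk1 hP hQ ha

end Privacy

/-- On the good outputs of the search for the crossing of the level `η` by the truncated losses at
all but the last element of `Y`, the corresponding element of `Y` has the required accuracy. -/
lemma accurate_of_mem_goodOutputs {𝒳 : Type u} [Bot 𝒳] {Y : Finset ℝ} {m : ℕ} (e : Fin (m + 1) ≃o Y)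
    (g : Dataset 𝒳 → Y) {n : ℕ} (x : Fin n → 𝒳) {η t : ℝ} (ht : 2 * η ≤ t) (ht0 : 0 ≤ t)
    {i : Fin (m + 1)} (hi : i ∈ goodOutputs (fun j : Fin m => truncate (2 * η)
      (shiftedInverseLoss (fun z => (g z : ℝ)) x (e j.castSucc))) η η) :
    (e i : ℝ) ≤ g ⟨n, x⟩ ∧ minAfterRemoval (fun z => (g z : ℝ)) x t ≤ e i := by
  constructor
  · -- The loss at the predecessor of `e i` is positive, so `g x` exceeds this predecessor.
    rcases Fin.eq_zero_or_eq_succ i with rfl | ⟨j, rfl⟩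
    · have : e 0 ≤ g ⟨n, x⟩ := by
        rw [← e.apply_symm_apply (g ⟨n, x⟩)]
        exact e.monotone (Fin.zero_le _)
      exact_mod_cast this
    · have hlt : e j.castSucc < g ⟨n, x⟩ := by
        by_contra! hcon
        have hcon' : (g ⟨n, x⟩ : ℝ) ≤ e j.castSucc := by exact_mod_cast hcon
        have hself : diff x x = fun _ => ⊥ := by funext i; simp [diff]
        have h0 : shiftedInverseLoss (fun z => (g z : ℝ)) x (e j.castSucc) = 0 := by
          have := shiftedInverseLoss_le (g := fun z => (g z : ℝ)) (x := x) (x' := x)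
            (fun _ => Or.inl rfl) hcon'
          rw [hself] at this
          simpa [size] using this
        have h2 := gt_of_mem_goodOutputs hi (Fin.val_succ j).symm
        rw [h0, sub_self] at h2
        simp [truncate] at h2
      have : e j.succ ≤ g ⟨n, x⟩ := by
        rw [← e.symm.lt_iff_lt, e.symm_apply_apply] at hlt
        rw [← e.symm.le_iff_le, e.symm_apply_apply]
        exact Fin.castSucc_lt_iff_succ_le.1 hlt
      exact_mod_cast this
  · have hbdd : BddBelow {v : ℝ | ∃ x' : Fin n → 𝒳, IsSub x' x ∧ (size x : ℝ) - t ≤ size x' ∧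
        (g ⟨n, x'⟩ : ℝ) = v} := by
      refine Y.finite_toSet.bddBelow.mono ?_
      rintro _ ⟨x', -, -, rfl⟩
      exact (g ⟨n, x'⟩).2
    suffices ∃ x', IsSub x' x ∧ (size x : ℝ) - t ≤ size x' ∧ (g ⟨n, x'⟩ : ℝ) ≤ e i by
      obtain ⟨x', hx', hs, hg⟩ := this
      exact (csInf_le hbdd ⟨x', hx', hs, rfl⟩).trans hg
    rcases Fin.eq_castSucc_or_eq_last i with ⟨j, rfl⟩ | rfl
    · have h1 := lt_of_mem_goodOutputs hi (Fin.val_castSucc j).symm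
      unfold truncate at h1
      split_ifs at h1 with htop
      · linarith
      obtain ⟨x', hx', hy, hv⟩ := exists_of_shiftedInverseLoss_ne_top htop
      refine ⟨x', hx', ?_, hy⟩
      rw [hv, ENat.toNat_natCast, min_lt_iff] at h1
      have h3 : (size (diff x x') : ℝ) < 2 * η := by
        rcases h1 with h1 | h1 <;> linarith
      rw [size_eq_size_add_size_diff hx']
      push_cast
      linarith
    · refine ⟨x, fun _ => Or.inl rfl, by linarith, ?_⟩
      have : g ⟨n, x⟩ ≤ e (Fin.last m) := by
        rw [← e.apply_symm_apply (g ⟨n, x⟩)]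
        exact e.monotone (Fin.le_last _)
      exact_mod_cast this

end ShiftedInverse

theorem mainTheorem7 :
    -- Shifted inverse mechanism.
    (∃ C : ℝ, 0 < C ∧
      ∀ (𝒳 : Type u) [Bot 𝒳] (Y : Finset ℝ) (ρ β : ℝ), 0 < ρ → 0 < β →
        ∃ Φ : (n : ℕ) → (Finset (Fin n) → Y) → ProbabilityMeasure Y,
          ∀ g : Dataset 𝒳 → Y, SubsetMonotone g →
            ∃ M : Dataset 𝒳 → ProbabilityMeasure Y,
              IsZCDP ρ M ∧
              IsGDP (√(2 * ρ)) M ∧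
              (∀ (n : ℕ) (x : Fin n → 𝒳),
                1 - β ≤ (M ⟨n, x⟩ : Measure Y).real
                  {y : Y | (y : ℝ) ≤ g ⟨n, x⟩ ∧
                    minAfterRemoval (fun z => (g z : ℝ)) x
                      (C * √(Real.log (Y.card / β) / ρ)) ≤ y}) ∧
              (∀ (n : ℕ) (x : Fin n → 𝒳), M ⟨n, x⟩ = Φ n (subsetValues g x)) ∧
              (NullInvariant g → NullInvariant M)) ∧
    -- Differentially private noisy binary search.
    (∃ C : ℝ, 0 < C ∧
      ∀ (𝒳 : Type u) [Bot 𝒳] (m : ℕ) (ℓ : Dataset 𝒳 → Fin m → ℝ) (ρ β τ : ℝ),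
        (∀ (n : ℕ) (x x' : Fin n → 𝒳) (y : Fin m),
          |ℓ ⟨n, x⟩ y - ℓ ⟨n, x'⟩ y| ≤ tupleDist x x') →
        (∀ x : Dataset 𝒳, Antitone (ℓ x)) →
        0 < ρ → 0 < β →
        ∃ η : ℝ, 0 ≤ η ∧ η ≤ C * √(Real.log (m / β) / ρ) ∧
          ∃ M : Dataset 𝒳 → ProbabilityMeasure (Fin (m + 1)),
            IsZCDP ρ M ∧
            IsGDP (√(2 * ρ)) M ∧
            (∀ x : Dataset 𝒳,
              1 - β ≤ (M x : Measure (Fin (m + 1))).real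
                {i | extended (ℓ x) (i + 1) < ((τ + η : ℝ) : EReal) ∧
                  ((τ - η : ℝ) : EReal) < extended (ℓ x) i}) ∧
            (NullInvariant ℓ → NullInvariant M)) ∧
    -- The shifted inverse loss has sensitivity 1 and is decreasing.
    (∀ (𝒳 : Type u) [Bot 𝒳] (g : Dataset 𝒳 → ℝ), SubsetMonotone g →
      (∀ (n : ℕ) (x : Fin n → 𝒳), Antitone (shiftedInverseLoss g x)) ∧
      ∀ (n : ℕ) (x x' : Fin n → 𝒳) (y : ℝ), g ⟨n, fun _ => ⊥⟩ ≤ y →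
        shiftedInverseLoss g x y ≠ ⊤ ∧
        shiftedInverseLoss g x y ≤ shiftedInverseLoss g x' y + tupleDist x x') := by
  refine ⟨⟨86, by norm_num, ?_⟩, ⟨43, by norm_num, ?_⟩, ?_⟩
  · intro 𝒳 _ Y ρ β hρ hβ
    -- If `Y` is empty, there is no `g`, and the table of its values is a function into `∅`.
    rcases Nat.eq_zero_or_eq_succ_pred Y.card with hY | hY
    · have hempty : IsEmpty Y := by
        rw [Finset.card_eq_zero] at hY
        rw [hY]
        infer_instance
      exact ⟨fun n v => (hempty.false (v ∅)).elim, fun g => (hempty.false (g ⟨0, Fin.elim0⟩)).elim⟩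
    set m := Y.card.pred
    let e : Fin (m + 1) ≃o Y := Y.orderIsoOfFin hY
    lift ρ to ℝ≥0 using hρ.le
    have hρ' : 0 < ρ := by exact_mod_cast hρ
    obtain ⟨η, hη0, hη, hF⟩ := exists_private_search m hρ' hβ
    obtain ⟨F, hsim, hacc⟩ := hF η
    let G : (n : ℕ) → (Finset (Fin n) → Y) → PMF Y := fun n v =>
      (F fun j => truncate (2 * η) (tableLoss (fun S => (v S : ℝ)) (e j.castSucc))).map e
    refine ⟨fun n v => ⟨(G n v).toMeasure, inferInstance⟩, fun g hg => ?_⟩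
    have hg' : SubsetMonotone fun z => (g z : ℝ) := fun n x' x h => by exact_mod_cast hg n x' x h
    let ℓ : Dataset 𝒳 → Fin m → ℝ := fun x j =>
      truncate (2 * η) (shiftedInverseLoss (fun z => (g z : ℝ)) x.2 (e j.castSucc))
    let P : Dataset 𝒳 → PMF Y := fun x => (F (ℓ x)).map e
    have hP : ∀ (n : ℕ) (x x' : Fin n → 𝒳), Neighbouring x x' →
        GaussianSimulable (2 * ρ) (P ⟨n, x⟩) (P ⟨n, x'⟩) := fun n x x' h =>
      (hsim _ _ fun j => (abs_truncate_sub_truncate_le hg' _ x x' _).trans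
        (by rw [h, Nat.cast_one])).map e
    refine ⟨toAlgorithm P, isZCDP_toAlgorithm hP, isGDP_toAlgorithm hP, fun n x => ?_, fun n x => ?_,
      fun hnull n x i => ?_⟩
    · rcases le_or_gt 1 β with hβ1 | hβ1
      · exact (sub_nonpos.2 hβ1).trans measureReal_nonneg
      have hanti : Antitone (ℓ ⟨n, x⟩) := fun j j' hjj' =>
        truncate_le_truncate (antitone_shiftedInverseLoss _ x
          (by exact_mod_cast e.monotone (Fin.castSucc_le_castSucc_iff.2 hjj')))
      have ht : 2 * η ≤ 86 * √(Real.log (Y.card / β) / ρ) := by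
        have hlog : Real.log (m / β) ≤ Real.log (Y.card / β) := by
          rcases Nat.eq_zero_or_pos m with h0 | h0
          · rw [h0, Nat.cast_zero, zero_div, Real.log_zero, hY, h0]
            refine Real.log_nonneg ?_
            rw [le_div_iff₀ hβ]
            push_cast
            linarith
          · refine Real.log_le_log (by positivity) ?_
            gcongr
            omega
        have : √(Real.log (m / β) / ρ) ≤ √(Real.log (Y.card / β) / ρ) := by gcongr
        linarith
      refine (hacc _ hanti).trans ?_
      change _ ≤ ((F (ℓ ⟨n, x⟩)).map e).toMeasure.real _
      rw [← PMF.toMeasure_map e _ (measurable_of_finite e), map_measureReal_apply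
        (measurable_of_finite e) (Set.toFinite _).measurableSet]
      exact measureReal_mono fun i hi => accurate_of_mem_goodOutputs e g x ht (by positivity) hi
    · have : ∀ y, shiftedInverseLoss (fun z => (g z : ℝ)) x y =
          tableLoss (fun S => (g ⟨n, restrict x S⟩ : ℝ)) y := fun y =>
        shiftedInverseLoss_eq_tableLoss (fun z => (g z : ℝ)) x y
      refine Subtype.ext (congrArg (fun p : PMF Y => p.toMeasure)
        (?_ : P ⟨n, x⟩ = G n (subsetValues g x)))
      simp only [P, ℓ, G, this, subsetValues]
    · have hnull' : NullInvariant fun z => (g z : ℝ) := fun n x i => congrArg _ (hnull n x i)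
      refine toAlgorithm_eq ?_
      simp only [P, ℓ, shiftedInverseLoss_insertNth_bot hnull']
  · intro 𝒳 _ m ℓ ρ β τ hsens hanti hρ hβ
    lift ρ to ℝ≥0 using hρ.le
    have hρ' : 0 < ρ := by exact_mod_cast hρ
    obtain ⟨η, hη0, hη, hF⟩ := exists_private_search m hρ' hβ
    obtain ⟨F, hsim, hacc⟩ := hF τ
    have hP : ∀ (n : ℕ) (x x' : Fin n → 𝒳), Neighbouring x x' →
        GaussianSimulable (2 * ρ) (F (ℓ ⟨n, x⟩)) (F (ℓ ⟨n, x'⟩)) := fun n x x' h =>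
      hsim _ _ fun y => (hsens n x x' y).trans (by rw [h, Nat.cast_one])
    refine ⟨η, hη0, hη, toAlgorithm fun x => F (ℓ x), isZCDP_toAlgorithm hP, isGDP_toAlgorithm hP,
      fun x => hacc _ (hanti x), fun hnull n x i => ?_⟩
    exact toAlgorithm_eq (by rw [hnull n x i])
  · intro 𝒳 _ g hg
    exact ⟨fun n x => antitone_shiftedInverseLoss g x, fun n x x' y hy =>
      ⟨shiftedInverseLoss_ne_top x hy, shiftedInverseLoss_le_add hg x x' y⟩⟩
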